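/- Let $d, \mathbf{d}, \mathbf{L}, M, K, N \in \mathbb{N} = \{1,2,\ldots\}$, $L, a, u \in \mathbb{R}$, $b \in (a,\infty)$, $v \in (u,\infty)$, $c \in [\max\{1, L, |a|, |b|, 2|u|, 2|v|\}, \infty)$, $B \in [c,\infty)$, $\mathbf{l} = (\mathbf{l}_0, \ldots, \mathbf{l}_{\mathbf{L}}) \in \mathbb{N}^{\mathbf{L}+1}$, $\mathbf{N} \subseteq \{0,1,\ldots,N\}$, $(\mathbf{J}_n)_{n\in\mathbb{N}} \subseteq \mathbb{N}$, $(\gamma_n)_{n\in\mathbb{N}} \subseteq \mathbb{R}$, and assume $0 \in \mathbf{N}$, $\mathbf{l}_0 = d$, $\mathbf{l}_{\mathbf{L}} = 1$, and $\mathbf{d} \geq \sum_{i=1}^{\mathbf{L}} \mathbf{l}_i(\mathbf{l}_{i-1}+1)$. Write $\|\mathbf{l}\|_\infty = \max\{\mathbf{l}_0, \ldots, \mathbf{l}_{\mathbf{L}}\}$. For $\theta \in \mathbb{R}^{\mathbf{d}}$ let $\mathscr{N}_\theta \colon \mathbb{R}^d \to \mathbb{R}$ be the clipped rectified network $$\mathscr{N}_\theta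 = \mathfrak{c} \circ A_{\mathbf{L}} \circ \mathfrak{R} \circ A_{\mathbf{L}-1} \circ \cdots \circ \mathfrak{R} \circ A_1,$$ where $\mathfrak{R}$ is the componentwise map $x \mapsto \max\{x,0\}$, $\mathfrak{c}(x) = \max\{u, \min\{x,v\}\}$, and $A_k \colon \mathbb{R}^{\mathbf{l}_{k-1}} \to \mathbb{R}^{\mathbf{l}_k}$ is the affine map whose weight matrix (row by row), followed by its bias vector, is given by the coordinates of $\theta$ with indices $s_k+1, \ldots, s_k + \mathbf{l}_k(\mathbf{l}_{k-1}+1)$, $s_k = \sum_{i=1}^{k-1} \mathbf{l}_i(\mathbf{l}_{i-1}+1)$. Let $(\Omega, \mathcal{F}, \mathbb{P})$ be a probability space, and let $X^{k,n}_j \colon \Omega \to [a,b]^d$ and $Y^{k,n}_j \colon \Omega \to [u,v]$, $k,n,j \in \mathbb{N}_0$, be functions such that $(X^{0,0}_j, Y^{0,0}_j)$, $j \in \{1,\ldots,M\}$, are i.i.d. random variables. Let $\mathcal{E} \colon [a,b]^d \to [u,v]$ satisfy $\mathcal{E}(X^{0,0}_1) = \mathbb{E}[Y^{0,0}_1 \mid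 X^{0,0}_1]$ $\mathbb{P}$-a.s. and $|\mathcal{E}(x) - \mathcal{E}(y)| \leq L \|x-y\|_1$ for all $x,y \in [a,b]^d$. For $k,n \in \mathbb{N}_0$, $J \in \mathbb{N}$, $\theta \in \mathbb{R}^{\mathbf{d}}$, $\omega \in \Omega$ let $$\mathcal{R}^{k,n}_J(\theta,\omega) = \frac1J \sum_{j=1}^J |\mathscr{N}_\theta(X^{k,n}_j(\omega)) - Y^{k,n}_j(\omega)|^2 .$$ Let $\Theta_{k,n} \colon \Omega \to \mathbb{R}^{\mathbf{d}}$, $k,n \in \mathbb{N}_0$, and $\mathbf{k} \colon \Omega \to (\mathbb{N}_0)^2$ be random variables. Assume that $\Theta_{k,0}(\Omega) \subseteq [-B,B]^{\mathbf{d}}$ for all $k \in \mathbb{N}$, that $\Theta_{k,0}$, $k \in \{1,\ldots,K\}$, are i.i.d., and that $\Theta_{1,0}$ is continuous uniformly distributed on $[-c,c]^{\mathbf{d}}$. Let $\mathcal{G}^{k,n} \colon \mathbb{R}^{\mathbf{d}} \times \Omega \to \mathbb{R}^{\mathbf{d}}$, $k,n \in \mathbb{N}$, be functions with $\mathcal{G}^{k,n}(\theta,\omega)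 = (\nabla_\theta \mathcal{R}^{k,n}_{\mathbf{J}_n})(\theta,\omega)$ for all $k,n\in\mathbb{N}$ and all $\omega \in \Omega$, $\theta \in \mathbb{R}^{\mathbf{d}}$ such that $\mathcal{R}^{k,n}_{\mathbf{J}_n}(\cdot,\omega)$ is differentiable at $\theta$. Assume for all $k,n \in \mathbb{N}$ that $\Theta_{k,n} = \Theta_{k,n-1} - \gamma_n \mathcal{G}^{k,n}(\Theta_{k,n-1})$, and for all $\omega \in \Omega$ that $$\mathbf{k}(\omega) \in \operatorname*{arg\,min}_{(l,m) \in \{1,\ldots,K\} \times \mathbf{N},\ \|\Theta_{l,m}(\omega)\|_\infty \leq B} \mathcal{R}^{0,0}_M(\Theta_{l,m}(\omega),\omega).$$ Then the function $\Omega \times [a,b]^d \ni (\omega,x) \mapsto |\mathscr{N}_{\Theta_{\mathbf{k}(\omega)}(\omega)}(x) - \mathcal{E}(x)|$ is measurable, the integrals below exist and are finite, and $$\begin{aligned} &\mathbb{E}\Bigl[\int_{[a,b]^d} |\mathscr{N}_{\Theta_{\mathbf{k}}}(x) - \mathcal{E}(x)| \, \mathbb{P}_{X^{0,0}_1}(\mathrm{d}x)\Bigr]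 \\ &\leq \frac{2\,[(v-u)\,\mathbf{L}\,(\|\mathbf{l}\|_\infty+1)^{\mathbf{L}}\, c^{\mathbf{L}+1}]^{1/2}}{K^{(2\mathbf{L})^{-1}(\|\mathbf{l}\|_\infty+1)^{-2}}} + \frac{3dL(b-a)}{[\min\{\mathbf{L},\mathbf{l}_1,\ldots,\mathbf{l}_{\mathbf{L}-1}\}]^{1/d}} + \frac{3\max\{1,v-u\}(\|\mathbf{l}\|_\infty+1)[2\mathbf{L}\ln(3MBc)]^{1/2}}{M^{1/4}} \\ &\leq \frac{6dc^2}{[\min\{\mathbf{L},\mathbf{l}_1,\ldots,\mathbf{l}_{\mathbf{L}-1}\}]^{1/d}} + \frac{5B^2\mathbf{L}(\|\mathbf{l}\|_\infty+1)\ln(eM)}{M^{1/4}} + \frac{2\mathbf{L}(\|\mathbf{l}\|_\infty+1)^{\mathbf{L}}c^{\mathbf{L}+1}}{K^{(2\mathbf{L})^{-1}(\|\mathbf{l}\|_\infty+1)^{-2}}} . \end{aligned}$$ -/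

import Mathlib

open MeasureTheory ProbabilityTheory

noncomputable section

/- Conventions: a layer-dimension vector `(l_0, …, l_depth)` is represented by a function
`l : ℕ → ℕ` of which only the entries with index `0, …, depth` are used.
Coordinates of parameter vectors are counted from `0`. -/

/-- Coordinate number `j` of `θ`. The value `0` is returned only for `j ≥ p`, which does not
occur when `θ` has enough coordinates for the network at hand. -/
def paramCoord {p : ℕ} (θ : Fin p → ℝ) (j : ℕ) : ℝ :=
  if h : j < p then θ ⟨j, h⟩ else 0

/-- The affine function `ℝ^n → ℝ^m` whose `m × n` weight matrix is stored row by row in the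
coordinates `s, …, s + m n - 1` of `θ`, and whose bias is stored in the next `m` coordinates. -/
def affineMapOf {p : ℕ} (θ : Fin p → ℝ) (s m n : ℕ) (x : Fin n → ℝ) : Fin m → ℝ :=
  fun i => (∑ j : Fin n, paramCoord θ (s + (i : ℕ) * n + (j : ℕ)) * x j)
    + paramCoord θ (s + m * n + (i : ℕ))

/-- `∑_{i=1}^{k} l_i (l_{i-1} + 1)`, the number of parameters of the first `k` layers. -/
def numParams (l : ℕ → ℕ) (k : ℕ) : ℕ :=
  ∑ i ∈ Finset.Icc 1 k, l i * (l (i - 1) + 1)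

/-- The fully connected feedforward network: after the `k`-th affine function (`k = 1, 2, …`)
the activation function `act k : ℝ^{l_k} → ℝ^{l_k}` is applied. -/
def network {p : ℕ} (θ : Fin p → ℝ) (l : ℕ → ℕ)
    (act : (k : ℕ) → (Fin (l k) → ℝ) → (Fin (l k) → ℝ)) :
    (k : ℕ) → (Fin (l 0) → ℝ) → (Fin (l k) → ℝ)
  | 0, x => x
  | k + 1, x =>
      act (k + 1) (affineMapOf θ (numParams l k) (l (k + 1)) (l k) (network θ l act k x))

/-- The rectifier function. -/
def rectifier (x : ℝ) : ℝ := max x 0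

/-- The clipping function. -/
def clipping (u v x : ℝ) : ℝ := max u (min x v)

/-- The rectified clipped network with `depth` affine layers: rectifiers after the layers
`1, …, depth - 1` and the clipping function after the last layer. -/
def clippedNetwork {p : ℕ} (θ : Fin p → ℝ) (l : ℕ → ℕ) (depth : ℕ) (u v : ℝ) :
    (Fin (l 0) → ℝ) → (Fin (l depth) → ℝ) :=
  network θ l
    (fun k y i => if k < depth then rectifier (y i) else clipping u v (y i)) depth

/-- The rectified clipped network as a function `ℝ^d → ℝ`, when `l_0 = d` and `l_depth = 1`. -/
def scalarNetwork {p d depth : ℕ} {l : ℕ → ℕ} (h0 : l 0 = d) (h1 : l depth = 1) (u v : ℝ)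
    (θ : Fin p → ℝ) (x : Fin d → ℝ) : ℝ :=
  clippedNetwork θ l depth u v (fun i => x (Fin.cast h0 i)) (Fin.cast h1.symm 0)

/-- `‖l‖_∞ = max {l_0, l_1, …, l_depth}`. -/
def maxWidth (l : ℕ → ℕ) (depth : ℕ) : ℕ := (Finset.range (depth + 1)).sup l

/-- `min {depth, l_1, l_2, …, l_{depth - 1}}`. -/
def minDepthWidth (l : ℕ → ℕ) (depth : ℕ) : ℕ :=
  (insert depth ((Finset.Ico 1 depth).image l)).min' (Finset.insert_nonempty _ _)

/-- The empirical risk `(1/J) ∑_{j=1}^{J} |f x_j - y_j|²`. -/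
def empiricalRisk {d : ℕ} (f : (Fin d → ℝ) → ℝ) (x : ℕ → Fin d → ℝ) (y : ℕ → ℝ) (J : ℕ) : ℝ :=
  (1 / (J : ℝ)) * ∑ j ∈ Finset.Icc 1 J, |f (x j) - y j| ^ 2

/-- The gradient of `f : ℝ^p → ℝ` as the vector of partial derivatives
(used only at points of differentiability). -/
def gradVec {p : ℕ} (f : (Fin p → ℝ) → ℝ) (θ : Fin p → ℝ) : Fin p → ℝ :=
  fun i => fderiv ℝ f θ (Pi.single i 1)

/-- The set of minimisers of `f` over `S`. -/
def argminOver {ι : Type*} (S : Set ι) (f : ι → ℝ) : Set ι :=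
  {i | i ∈ S ∧ ∀ j ∈ S, f i ≤ f j}

/-- `Z_1, …, Z_n` are independent and identically distributed random variables. -/
def IsIID {Ω α : Type*} [MeasurableSpace Ω] [MeasurableSpace α]
    (P : Measure Ω) (n : ℕ) (Z : ℕ → Ω → α) : Prop :=
  (∀ j ∈ Finset.Icc 1 n, Measurable (Z j)) ∧
  iIndepFun (fun (j : Finset.Icc 1 n) => Z j) P ∧
  ∀ j ∈ Finset.Icc 1 n, IdentDistrib (Z j) (Z 1) P P

/-- The cube `[a, b]^n`. -/
def cube (n : ℕ) (a b : ℝ) : Set (Fin n → ℝ) := Set.Icc (fun _ => a) (fun _ => b)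

end

/-! The mean squared error is bounded by a sum of three squares, one for each term of the first
estimate; a Cauchy-Schwarz argument then passes to the mean absolute error.

Since `Y - E[Y|X]` is orthogonal to bounded functions of `X`, the squared L² error of a network is
its excess risk over the regression function (`integral_sq_sub_eq_risk_sub_risk`). Fix a parameter
`η` in the cube of radius `c` whose network approximates the regression function well. The risk of
the selected parameter is compared with its empirical risk, this with the empirical risk of the
initialisation closest to `η` (step 0 is admissible, so every `Θ k 0` competes in the arg min), this
with the empirical risk of `η`, and this with the risk of `η`. The cost is twice a uniform
deviation, a multiple of the distance from `η` to the closest initialisation, and the squared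
approximation error.

Approximation (`exists_scalarNetwork_approx`): the maximum over a grid of the cones `E y - Lip * ‖x
- y‖₁` lies below `E` and is close to it near grid points. A network computes it by building all
cones in two layers and absorbing one cone per later layer into a running maximum.

Generalisation (`exists_uniform_deviation_bound`): Hoeffding's lemma controls exponential moments at
finitely many parameters. A smoothed maximum bounds all these deviations at once, and Lipschitz
dependence of the network on its parameters (`abs_scalarNetwork_sub_le`) extends the bound to the
whole ball.

Optimisation (`exists_min_headDist_bound`): among `K` independent uniform points the closest one to
`η`, in the `q` coordinates that matter, has expected distance at most `2 c K^(-1/q)`. The same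
Lipschitz bound converts this into a difference of risks. -/

/-! ### Parameter indices, activations and continuity of the network -/

lemma numParams_succ (l : ℕ → ℕ) (k : ℕ) :
    numParams l (k + 1) = numParams l k + l (k + 1) * (l k + 1) := by
  unfold numParams
  rw [Finset.sum_Icc_succ_top (by omega)]
  simp

lemma numParams_mono (l : ℕ → ℕ) : Monotone (numParams l) :=
  monotone_nat_of_le_succ fun k => by rw [numParams_succ]; omega

lemma weight_index_lt {l : ℕ → ℕ} {k i j : ℕ} (hi : i < l (k + 1)) (hj : j < l k) :
    numParams l k + i * l k + j < numParams l (k + 1) := by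
  rw [numParams_succ]
  nlinarith [Nat.mul_le_mul_right (l k) (Nat.succ_le_of_lt hi)]

lemma bias_index_lt {l : ℕ → ℕ} {k i : ℕ} (hi : i < l (k + 1)) :
    numParams l k + l (k + 1) * l k + i < numParams l (k + 1) := by
  rw [numParams_succ]
  nlinarith

/-- The activation functions of the rectified clipped network. -/
def clipAct (l : ℕ → ℕ) (depth : ℕ) (u v : ℝ) (k : ℕ) (y : Fin (l k) → ℝ) : Fin (l k) → ℝ :=
  fun i => if k < depth then rectifier (y i) else clipping u v (y i)

lemma clippedNetwork_eq {p : ℕ} (θ : Fin p → ℝ) (l : ℕ → ℕ) (depth : ℕ) (u v : ℝ) :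
    clippedNetwork θ l depth u v = network θ l (clipAct l depth u v) depth := rfl

lemma abs_rectifier_sub_le (x y : ℝ) : |rectifier x - rectifier y| ≤ |x - y| :=
  abs_max_sub_max_le_abs x y 0

lemma abs_rectifier_le (x : ℝ) : |rectifier x| ≤ |x| := by
  have := abs_rectifier_sub_le x 0
  simpa [rectifier] using this

lemma abs_clipping_sub_le (u v x y : ℝ) : |clipping u v x - clipping u v y| ≤ |x - y| := by
  unfold clipping
  rw [max_comm u, max_comm u]
  refine (abs_max_sub_max_le_abs _ _ u).trans ?_
  exact abs_min_sub_min_le_max x v y v |>.trans (by simp)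

lemma clipping_mem {u v : ℝ} (huv : u ≤ v) (x : ℝ) : clipping u v x ∈ Set.Icc u v :=
  ⟨le_max_left _ _, max_le huv (min_le_right _ _)⟩

lemma clipping_of_mem {u v x : ℝ} (hx : x ∈ Set.Icc u v) : clipping u v x = x := by
  unfold clipping
  rw [min_eq_left hx.2, max_eq_right hx.1]

lemma continuous_rectifier : Continuous rectifier := continuous_id.max continuous_const

lemma continuous_clipping (u v : ℝ) : Continuous (clipping u v) :=
  continuous_const.max (continuous_id.min continuous_const)

lemma abs_clipAct_sub_le {l : ℕ → ℕ} {depth : ℕ} {u v : ℝ} {k : ℕ} (y z : Fin (l k) → ℝ)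
    (i : Fin (l k)) :
    |clipAct l depth u v k y i - clipAct l depth u v k z i| ≤ |y i - z i| := by
  unfold clipAct
  split_ifs
  · exact abs_rectifier_sub_le _ _
  · exact abs_clipping_sub_le _ _ _ _

lemma continuous_clipAct (l : ℕ → ℕ) (depth : ℕ) (u v : ℝ) (k : ℕ) :
    Continuous (clipAct l depth u v k) := by
  refine continuous_pi fun i => ?_
  unfold clipAct
  split_ifs
  · exact continuous_rectifier.comp (continuous_apply i)
  · exact (continuous_clipping u v).comp (continuous_apply i)

lemma continuous_paramCoord {p : ℕ} (t : ℕ) :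
    Continuous (fun θ : Fin p → ℝ => paramCoord θ t) := by
  unfold paramCoord
  split_ifs
  · exact continuous_apply _
  · exact continuous_const

lemma continuous_network {p : ℕ} (l : ℕ → ℕ) {act : (k : ℕ) → (Fin (l k) → ℝ) → (Fin (l k) → ℝ)}
    (hact : ∀ k, Continuous (act k)) (k : ℕ) :
    Continuous (fun z : (Fin p → ℝ) × (Fin (l 0) → ℝ) => network z.1 l act k z.2) := by
  induction k with
  | zero => exact continuous_snd
  | succ k ih =>
    refine (hact (k + 1)).comp (continuous_pi fun i => ?_)
    refine Continuous.add (continuous_finsetSum _ fun j _ => ?_)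
      ((continuous_paramCoord _).comp continuous_fst)
    exact ((continuous_paramCoord _).comp continuous_fst).mul ((continuous_apply j).comp ih)

lemma continuous_scalarNetwork {p d depth : ℕ} {l : ℕ → ℕ} (h0 : l 0 = d) (h1 : l depth = 1)
    (u v : ℝ) :
    Continuous (fun z : (Fin p → ℝ) × (Fin d → ℝ) => scalarNetwork h0 h1 u v z.1 z.2) := by
  have h := continuous_network (p := p) l (continuous_clipAct l depth u v) depth
  have h2 : Continuous (fun z : (Fin p → ℝ) × (Fin d → ℝ) =>
      (z.1, fun i : Fin (l 0) => z.2 (Fin.cast h0 i))) :=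
    continuous_fst.prodMk (continuous_pi fun i => (continuous_apply _).comp continuous_snd)
  exact (continuous_apply (Fin.cast h1.symm 0)).comp (h.comp h2)

lemma scalarNetwork_mem {p d depth : ℕ} {l : ℕ → ℕ} (h0 : l 0 = d) (h1 : l depth = 1)
    (hdepth : 1 ≤ depth) {u v : ℝ} (huv : u ≤ v) (θ : Fin p → ℝ) (x : Fin d → ℝ) :
    scalarNetwork h0 h1 u v θ x ∈ Set.Icc u v := by
  unfold scalarNetwork
  rw [clippedNetwork_eq]
  obtain ⟨k, rfl⟩ : ∃ k, depth = k + 1 := ⟨depth - 1, by omega⟩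
  simp only [network, clipAct, lt_irrefl, if_false]
  exact clipping_mem huv _

lemma width_le_maxWidth {l : ℕ → ℕ} {depth k : ℕ} (hk : k ≤ depth) : l k ≤ maxWidth l depth :=
  Finset.le_sup (f := l) (Finset.mem_range.2 (Nat.lt_succ_of_le hk))

lemma numParams_le {l : ℕ → ℕ} {depth w : ℕ} (hw : ∀ k ≤ depth, l k ≤ w) :
    numParams l depth ≤ depth * (w * (w + 1)) := by
  unfold numParams
  refine (Finset.sum_le_card_nsmul _ _ (w * (w + 1)) fun i hi => ?_).trans (by simp)
  have := Finset.mem_Icc.1 hi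
  exact Nat.mul_le_mul (hw i this.2) (Nat.succ_le_succ (hw _ (by omega)))

/-! ### Growth of the layers and Lipschitz dependence on the parameters -/

lemma abs_affineMapOf_le {p : ℕ} {θ : Fin p → ℝ} {l : ℕ → ℕ} {k w : ℕ} (hw : l k ≤ w) {C R : ℝ}
    (hC : 0 ≤ C) (hR : 1 ≤ R) (hθ : ∀ t < numParams l (k + 1), |paramCoord θ t| ≤ C)
    {x : Fin (l k) → ℝ} (hx : ∀ i, |x i| ≤ R) (i : Fin (l (k + 1))) :
    |affineMapOf θ (numParams l k) (l (k + 1)) (l k) x i| ≤ C * (w + 1) * R := by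
  unfold affineMapOf
  have h1 : |∑ j : Fin (l k), paramCoord θ (numParams l k + (i : ℕ) * l k + (j : ℕ)) * x j|
      ≤ w * (C * R) := by
    refine (Finset.abs_sum_le_sum_abs _ _).trans ?_
    refine (Finset.sum_le_card_nsmul _ _ (C * R) fun j _ => ?_).trans ?_
    · rw [abs_mul]
      exact mul_le_mul (hθ _ (weight_index_lt i.2 j.2)) (hx j) (abs_nonneg _) hC
    · simp only [Finset.card_univ, Fintype.card_fin, nsmul_eq_mul]
      gcongr
  have h2 := hθ _ (bias_index_lt i.2)
  refine (abs_add_le _ _).trans ?_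
  nlinarith

lemma abs_affineMapOf_sub_le {p : ℕ} {θ η : Fin p → ℝ} {l : ℕ → ℕ} {k w : ℕ} (hw : l k ≤ w)
    {C R ε δ : ℝ} (hC : 0 ≤ C) (hR : 1 ≤ R) (hε : 0 ≤ ε) (hδ : 0 ≤ δ)
    (hη : ∀ t < numParams l (k + 1), |paramCoord η t| ≤ C)
    (hθη : ∀ t < numParams l (k + 1), |paramCoord θ t - paramCoord η t| ≤ ε)
    {x y : Fin (l k) → ℝ} (hx : ∀ i, |x i| ≤ R) (hxy : ∀ i, |x i - y i| ≤ δ)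
    (i : Fin (l (k + 1))) :
    |affineMapOf θ (numParams l k) (l (k + 1)) (l k) x i
      - affineMapOf η (numParams l k) (l (k + 1)) (l k) y i|
      ≤ ε * (w + 1) * R + C * (w + 1) * δ := by
  unfold affineMapOf
  rw [add_sub_add_comm, ← Finset.sum_sub_distrib]
  refine (abs_add_le _ _).trans ?_
  have h1 : |∑ j : Fin (l k), (paramCoord θ (numParams l k + (i : ℕ) * l k + (j : ℕ)) * x j
      - paramCoord η (numParams l k + (i : ℕ) * l k + (j : ℕ)) * y j)|
      ≤ w * (ε * R + C * δ) := by
    refine (Finset.abs_sum_le_sum_abs _ _).trans ?_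
    refine (Finset.sum_le_card_nsmul _ _ (ε * R + C * δ) fun j _ => ?_).trans ?_
    · have hi := weight_index_lt i.2 j.2
      generalize numParams l k + (i : ℕ) * l k + (j : ℕ) = t at hi ⊢
      have : paramCoord θ t * x j - paramCoord η t * y j
          = (paramCoord θ t - paramCoord η t) * x j + paramCoord η t * (x j - y j) := by ring
      rw [this]
      refine (abs_add_le _ _).trans ?_
      rw [abs_mul, abs_mul]
      exact add_le_add (mul_le_mul (hθη t hi) (hx j) (abs_nonneg _) hε)
        (mul_le_mul (hη t hi) (hxy j) (abs_nonneg _) hC)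
    · simp only [Finset.card_univ, Fintype.card_fin, nsmul_eq_mul]
      gcongr
  have h2 := hθη _ (bias_index_lt i.2)
  have h3 : ε ≤ ε * R := le_mul_of_one_le_right hε hR
  have h4 : 0 ≤ C * δ := mul_nonneg hC hδ
  nlinarith

/-- Each layer multiplies the bound by `C * (w + 1)`: at most `w` weighted inputs and one bias, the
latter absorbed because the input bound is at least 1. The last layer is excluded, since clipping,
unlike the rectifier, can increase absolute values. -/
lemma abs_network_le {p : ℕ} {θ : Fin p → ℝ} {l : ℕ → ℕ} {depth w : ℕ} {u v C : ℝ}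
    (hw : ∀ k ≤ depth, l k ≤ w) (hC : 1 ≤ C)
    (hθ : ∀ t < numParams l depth, |paramCoord θ t| ≤ C)
    {x : Fin (l 0) → ℝ} (hx : ∀ i, |x i| ≤ C) (k : ℕ) (hk : k < depth) (i : Fin (l k)) :
    |network θ l (clipAct l depth u v) k x i| ≤ ((w : ℝ) + 1) ^ k * C ^ (k + 1) := by
  induction k with
  | zero => simpa [network] using hx i
  | succ k ih =>
    have hw0 : (0 : ℝ) ≤ w := Nat.cast_nonneg w
    have h := abs_affineMapOf_le (θ := θ) (hw k (by omega)) (by linarith : 0 ≤ C)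
      (one_le_mul_of_one_le_of_one_le (one_le_pow₀ (by linarith : (1 : ℝ) ≤ (w : ℝ) + 1))
        (one_le_pow₀ hC))
      (fun t ht => hθ t (ht.trans_le (numParams_mono l hk.le))) (fun j => ih (by omega) j) i
    have h2 : network θ l (clipAct l depth u v) (k + 1) x i
        = rectifier (affineMapOf θ (numParams l k) (l (k + 1)) (l k)
          (network θ l (clipAct l depth u v) k x) i) := by
      simp [network, clipAct, hk]
    rw [h2]
    refine (abs_rectifier_le _).trans (h.trans (le_of_eq (by ring)))

/-- Activations are 1-Lipschitz, so a layer scales the inherited difference by `C * (w + 1)` and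
adds `ε * (w + 1)` times the size of its input. By `abs_network_le` all these contributions are of
equal size after propagation, whence the factor `k`. -/
lemma abs_network_sub_le {p : ℕ} {θ η : Fin p → ℝ} {l : ℕ → ℕ} {depth w : ℕ} {u v C ε : ℝ}
    (hw : ∀ k ≤ depth, l k ≤ w) (hC : 1 ≤ C) (hε : 0 ≤ ε)
    (hθ : ∀ t < numParams l depth, |paramCoord θ t| ≤ C)
    (hη : ∀ t < numParams l depth, |paramCoord η t| ≤ C)
    (hθη : ∀ t < numParams l depth, |paramCoord θ t - paramCoord η t| ≤ ε)
    {x : Fin (l 0) → ℝ} (hx : ∀ i, |x i| ≤ C) (k : ℕ) (hk : k ≤ depth) (i : Fin (l k)) :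
    |network θ l (clipAct l depth u v) k x i - network η l (clipAct l depth u v) k x i|
      ≤ k * ((w : ℝ) + 1) ^ k * C ^ k * ε := by
  induction k with
  | zero => simp [network]
  | succ k ih =>
    have hw0 : (0 : ℝ) ≤ w := Nat.cast_nonneg w
    have hlt : ∀ t < numParams l (k + 1), t < numParams l depth :=
      fun t ht => ht.trans_le (numParams_mono l hk)
    have h := abs_affineMapOf_sub_le (θ := θ) (η := η) (hw k (by omega)) (by linarith : 0 ≤ C)
      (one_le_mul_of_one_le_of_one_le (one_le_pow₀ (by linarith : (1 : ℝ) ≤ (w : ℝ) + 1))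
        (one_le_pow₀ hC)) hε (by positivity)
      (fun t ht => hη t (hlt t ht)) (fun t ht => hθη t (hlt t ht))
      (fun j => abs_network_le (u := u) (v := v) hw hC hθ hx k (by omega) j)
      (fun j => ih (by omega) j) i
    refine (abs_clipAct_sub_le _ _ _).trans (h.trans (le_of_eq ?_))
    push_cast
    ring

lemma abs_scalarNetwork_sub_le {p d depth : ℕ} {l : ℕ → ℕ} (h0 : l 0 = d) (h1 : l depth = 1)
    {u v C ε : ℝ} (hC : 1 ≤ C) (hε : 0 ≤ ε) {θ η : Fin p → ℝ}
    (hθ : ∀ i : Fin p, (i : ℕ) < numParams l depth → |θ i| ≤ C)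
    (hη : ∀ i : Fin p, (i : ℕ) < numParams l depth → |η i| ≤ C)
    (hθη : ∀ i : Fin p, (i : ℕ) < numParams l depth → |θ i - η i| ≤ ε)
    {x : Fin d → ℝ} (hx : ∀ i, |x i| ≤ C) :
    |scalarNetwork h0 h1 u v θ x - scalarNetwork h0 h1 u v η x|
      ≤ depth * ((maxWidth l depth : ℝ) + 1) ^ depth * C ^ depth * ε := by
  have key : ∀ ζ : Fin p → ℝ, (∀ i : Fin p, (i : ℕ) < numParams l depth → |ζ i| ≤ C) →
      ∀ t < numParams l depth, |paramCoord ζ t| ≤ C := by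
    intro ζ hζ t ht
    unfold paramCoord
    split_ifs with h
    · exact hζ ⟨t, h⟩ ht
    · simp; linarith
  refine abs_network_sub_le (fun k hk => width_le_maxWidth hk) hC hε (key θ hθ) (key η hη) ?_
    (fun i => hx _) depth le_rfl _
  intro t ht
  unfold paramCoord
  split_ifs with h
  · exact hθη ⟨t, h⟩ ht
  · simpa using hε

/-! ### Networks with prescribed weights -/

/-- Every choice of weight matrices and bias vectors is realised by a parameter vector. -/
lemma exists_paramCoord_eq {l : ℕ → ℕ} {depth p : ℕ} (hp : numParams l depth ≤ p)
    {c : ℝ} (hc : 0 ≤ c) (W : ℕ → ℕ → ℕ → ℝ) (β : ℕ → ℕ → ℝ) (hW : ∀ k i j, |W k i j| ≤ c)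
    (hβ : ∀ k i, |β k i| ≤ c) :
    ∃ θ ∈ cube p (-c) c, ∀ k < depth, ∀ i < l (k + 1),
      (∀ j < l k, paramCoord θ (numParams l k + i * l k + j) = W k i j) ∧
      paramCoord θ (numParams l k + l (k + 1) * l k + i) = β k i := by
  have key : ∀ m, ∃ f : ℕ → ℝ, (∀ t, |f t| ≤ c) ∧ ∀ k < m, ∀ i < l (k + 1),
      (∀ j < l k, f (numParams l k + i * l k + j) = W k i j) ∧
      f (numParams l k + l (k + 1) * l k + i) = β k i := by
    intro m
    induction m with
    | zero => exact ⟨0, by simpa using hc, by simp⟩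
    | succ m ih =>
      obtain ⟨f, hf, hf2⟩ := ih
      -- Earlier layers keep their coordinates. In the new block, division with remainder by the row
      -- length `l m` recovers row and column, and everything beyond the weights is read as bias.
      refine ⟨fun t => if t < numParams l m then f t else
        if t < numParams l m + l (m + 1) * l m
          then W m ((t - numParams l m) / l m) ((t - numParams l m) % l m)
          else β m (t - numParams l m - l (m + 1) * l m), ?_, ?_⟩
      · intro t
        dsimp only
        split_ifs
        · exact hf t
        · exact hW _ _ _
        · exact hβ _ _
      · intro k hk i hi
        rcases Nat.lt_succ_iff_lt_or_eq.1 hk with hk' | rfl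
        · have hle := numParams_mono l (show k + 1 ≤ m by omega)
          constructor
          · intro j hj
            have := weight_index_lt (l := l) (k := k) hi hj
            dsimp only
            rw [if_pos (by omega)]
            exact (hf2 k hk' i hi).1 j hj
          · have := bias_index_lt (l := l) (k := k) hi
            dsimp only
            rw [if_pos (by omega)]
            exact (hf2 k hk' i hi).2
        · constructor
          · intro j hj
            have h1 : i * l k + j < l (k + 1) * l k := by
              nlinarith [Nat.mul_le_mul_right (l k) (Nat.succ_le_of_lt hi)]
            dsimp only
            rw [if_neg (by omega), if_pos (by omega)]
            have h2 : numParams l k + i * l k + j - numParams l k = j + l k * i := by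
              rw [mul_comm i]; omega
            rw [h2, Nat.add_mul_div_left _ _ (by omega), Nat.add_mul_mod_self_left,
              Nat.div_eq_of_lt hj, Nat.mod_eq_of_lt hj, zero_add]
          · dsimp only
            rw [if_neg (by omega), if_neg (by omega)]
            congr 1
            omega
  obtain ⟨f, hf, hf2⟩ := key depth
  refine ⟨fun i => f i, ⟨fun i => (abs_le.1 (hf i)).1, fun i => (abs_le.1 (hf i)).2⟩, ?_⟩
  have hpc : ∀ t < numParams l depth, paramCoord (fun i : Fin p => f i) t = f t := by
    intro t ht
    unfold paramCoord
    rw [dif_pos (ht.trans_le hp)]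
  intro k hk i hi
  have hle := numParams_mono l (show k + 1 ≤ depth by omega)
  constructor
  · intro j hj
    rw [hpc _ ((weight_index_lt hi hj).trans_le hle)]
    exact (hf2 k hk i hi).1 j hj
  · rw [hpc _ ((bias_index_lt hi).trans_le hle)]
    exact (hf2 k hk i hi).2

/-- The outputs of the neurons of layer `k`, extended by zero. -/
def neuron {p : ℕ} (θ : Fin p → ℝ) (l : ℕ → ℕ) (depth : ℕ) (u v : ℝ) (x : Fin (l 0) → ℝ)
    (k i : ℕ) : ℝ :=
  if h : i < l k then network θ l (clipAct l depth u v) k x ⟨i, h⟩ else 0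

/-- With neurons indexed by plain naturals, the layer recursion becomes a sum over a range, free of
dependent types. -/
lemma neuron_succ {p : ℕ} {θ : Fin p → ℝ} {l : ℕ → ℕ} {depth : ℕ} {u v : ℝ}
    {x : Fin (l 0) → ℝ} {W : ℕ → ℕ → ℕ → ℝ} {β : ℕ → ℕ → ℝ} {k : ℕ}
    (hθ : ∀ i < l (k + 1),
      (∀ j < l k, paramCoord θ (numParams l k + i * l k + j) = W k i j) ∧
      paramCoord θ (numParams l k + l (k + 1) * l k + i) = β k i) {i : ℕ} (hi : i < l (k + 1)) :
    neuron θ l depth u v x (k + 1) i = if k + 1 < depth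
      then max (∑ j ∈ Finset.range (l k), W k i j * neuron θ l depth u v x k j + β k i) 0
      else clipping u v
        (∑ j ∈ Finset.range (l k), W k i j * neuron θ l depth u v x k j + β k i) := by
  have h : affineMapOf θ (numParams l k) (l (k + 1)) (l k)
      (network θ l (clipAct l depth u v) k x) ⟨i, hi⟩
      = ∑ j ∈ Finset.range (l k), W k i j * neuron θ l depth u v x k j + β k i := by
    unfold affineMapOf
    rw [(hθ i hi).2, Finset.sum_range]
    congr 1
    refine Finset.sum_congr rfl fun j _ => ?_
    rw [(hθ i hi).1 j j.2]
    simp [neuron]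
  rw [← h]
  simp [neuron, hi, network, clipAct, rectifier]

lemma sum_range_mul_of_le_one {m : ℕ} (hm : 2 ≤ m) {w h : ℕ → ℝ} {s : ℝ} (h0 : w 0 = s)
    (h1 : w 1 = s) (hw : ∀ j, 2 ≤ j → w j = 0) :
    ∑ j ∈ Finset.range m, w j * h j = s * (h 0 + h 1) := by
  obtain ⟨m, rfl⟩ := Nat.exists_eq_add_of_le hm
  rw [Finset.sum_range_add, Finset.sum_eq_zero (s := Finset.range m)
    (fun j _ => by rw [hw _ (by omega), zero_mul])]
  simp [Finset.sum_range_succ, h0, h1]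
  ring

lemma sum_range_block {m D n j : ℕ} (hD : 0 < D) (hj : j < n) (hm : D * n ≤ m) (s : ℝ)
    (h : ℕ → ℝ) :
    ∑ t ∈ Finset.range m, (if t / D = j then s else 0) * h t
      = s * ∑ r ∈ Finset.range D, h (D * j + r) := by
  have hle : D * j + D ≤ D * n := by
    rw [← Nat.mul_succ]; exact Nat.mul_le_mul_left _ hj
  obtain ⟨m, rfl⟩ := Nat.exists_eq_add_of_le (hle.trans hm)
  rw [Finset.sum_range_add, Finset.sum_range_add, Finset.sum_eq_zero, Finset.sum_eq_zero
    (s := Finset.range m), zero_add, add_zero, Finset.mul_sum]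
  · refine Finset.sum_congr rfl fun r hr => ?_
    have hr := Finset.mem_range.1 hr
    rw [if_pos]
    rw [Nat.mul_add_div hD, Nat.div_eq_of_lt hr, add_zero]
  · intro r _
    rw [if_neg, zero_mul]
    have : j + 1 ≤ (D * j + D + r) / D := by
      rw [Nat.le_div_iff_mul_le hD]; nlinarith
    omega
  · intro r hr
    have hr := Finset.mem_range.1 hr
    rw [if_neg, zero_mul]
    have : r / D < j := by rw [Nat.div_lt_iff_lt_mul hD]; nlinarith
    omega

/-! ### The network computing a maximum of cones -/

/-- Weights of the network computing `x ↦ max_j (e_j - Lip ‖x - y_j‖₁)` for `n` points `y_j`. -/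
def maxConvWeight (D n : ℕ) (Lip : ℝ) (k i j : ℕ) : ℝ :=
  if k = 0 then (if i % (2 * D) % D = j then (if i % (2 * D) < D then 1 else -1) else 0)
  else if k = 1 then (if i < 2 then 0 else if j / (2 * D) = i - 2 then -Lip else 0)
  else if i = 0 then (if j ≤ 1 then 1 else 0)
  else if i = 1 then (if j ≤ 1 then -1 else if j = k ∧ k < n + 2 then 1 else 0)
  else if j = i then 1 else 0

/-- Biases of the network computing `x ↦ max_j (e_j - Lip ‖x - y_j‖₁)`. -/
def maxConvBias (D depth : ℕ) (u : ℝ) (y : ℕ → ℕ → ℝ) (e : ℕ → ℝ) (k i : ℕ) : ℝ :=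
  if k = 0 then (if i % (2 * D) < D then - y (i / (2 * D)) (i % (2 * D) % D)
    else y (i / (2 * D)) (i % (2 * D) % D))
  else if k = 1 then (if i < 2 then 0 else e (i - 2) - u)
  else if k + 1 = depth then u else 0

/-- Layer 1 holds the positive and negative parts of all `x i - y j i`, whose sums are the absolute
values. Layer 2 holds the cones in neurons `2 + j`, lowered by `u` and cut off at 0; being
nonnegative, they are then copied unchanged by rectifiers. From layer 2 on, neurons 0 and 1 have the
running maximum as their sum, and the output bias restores `u`. The maximum itself is not named: the
output lies above every cone and below any `z` in `[u, v]` that dominates them. -/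
lemma exists_network_maxConv {p depth n : ℕ} {l : ℕ → ℕ} (h1 : l depth = 1)
    (hp : numParams l depth ≤ p) (hd : 1 ≤ l 0) {Lip u v c : ℝ} (hc : 1 ≤ c)
    (hLip : 0 ≤ Lip) (hLipc : Lip ≤ c) (hu : |u| ≤ c) (hvu : v - u ≤ c) (hn : n + 3 ≤ depth)
    (hl1 : 2 * l 0 * n ≤ l 1) (hlk : ∀ k, 2 ≤ k → k < depth → n + 2 ≤ l k)
    {y : ℕ → ℕ → ℝ} (hy : ∀ j i, |y j i| ≤ c) {e : ℕ → ℝ} (he : ∀ j, e j ∈ Set.Icc u v) :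
    ∃ θ ∈ cube p (-c) c, ∀ x : Fin (l 0) → ℝ, ∀ z ∈ Set.Icc u v,
      (∀ j < n, e j - Lip * ∑ i : Fin (l 0), |x i - y j i| ≤ z) →
      (∀ j < n, e j - Lip * ∑ i : Fin (l 0), |x i - y j i| ≤
        scalarNetwork rfl h1 u v θ x) ∧ scalarNetwork rfl h1 u v θ x ≤ z := by
  have hc0 : 0 ≤ c := by linarith
  obtain ⟨θ, hθc, hθ⟩ := exists_paramCoord_eq hp hc0 (maxConvWeight (l 0) n Lip)
    (maxConvBias (l 0) depth u y e)
    (by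
      intro k i j
      unfold maxConvWeight
      split_ifs <;> simp [abs_of_nonneg hLip, hLipc, hc, hc0])
    (by
      intro k i
      unfold maxConvBias
      split_ifs <;> (try simp only [abs_neg, abs_zero, hy, hc0, hu])
      rw [abs_of_nonneg (by linarith [(he (i - 2)).1])]
      linarith [(he (i - 2)).2])
  refine ⟨θ, hθc, fun x z hz hez => ?_⟩
  set H : ℕ → ℕ → ℝ := neuron θ l depth u v x with hH
  have step : ∀ k, k + 1 < depth → ∀ i < l (k + 1), H (k + 1) i
      = max (∑ j ∈ Finset.range (l k), maxConvWeight (l 0) n Lip k i j * H k j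
        + maxConvBias (l 0) depth u y e k i) 0 := by
    intro k hk i hi
    rw [hH, neuron_succ (hθ k (by omega)) hi, if_pos hk]
  have hH0 : ∀ i : Fin (l 0), H 0 i = x i := by
    intro i
    simp [hH, neuron, network]
  -- the first layer
  have layer1 : ∀ j < n, ∀ i : Fin (l 0), H 1 (2 * l 0 * j + i) + H 1 (2 * l 0 * j + (l 0 + i))
      = |x i - y j i| := by
    intro j hj i
    have hi := i.2
    have hle : 2 * l 0 * j + 2 * l 0 ≤ 2 * l 0 * n := by
      rw [← Nat.mul_succ]; exact Nat.mul_le_mul_left _ hj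
    have hD : 0 < 2 * l 0 := by omega
    rw [step 0 (by omega) _ (show _ < l 1 by omega), step 0 (by omega) _ (show _ < l 1 by omega)]
    have e1 : (2 * l 0 * j + (i : ℕ)) / (2 * l 0) = j := by
      rw [Nat.mul_add_div hD, Nat.div_eq_of_lt (by omega), add_zero]
    have e2 : (2 * l 0 * j + (l 0 + (i : ℕ))) / (2 * l 0) = j := by
      rw [Nat.mul_add_div hD, Nat.div_eq_of_lt (by omega), add_zero]
    have e3 : (2 * l 0 * j + (i : ℕ)) % (2 * l 0) = i := by
      rw [Nat.mul_add_mod, Nat.mod_eq_of_lt (by omega)]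
    have e4 : (2 * l 0 * j + (l 0 + (i : ℕ))) % (2 * l 0) = l 0 + i := by
      rw [Nat.mul_add_mod, Nat.mod_eq_of_lt (by omega)]
    have e5 : (l 0 + (i : ℕ)) % l 0 = i := by
      rw [Nat.add_mod_left, Nat.mod_eq_of_lt hi]
    simp only [maxConvWeight, maxConvBias, if_true, e1, e2, e3, e4, e5, Nat.mod_eq_of_lt hi, hi,
      ite_mul, zero_mul, Finset.sum_ite_eq, Finset.mem_range, hH0, if_neg (show ¬ l 0 + (i : ℕ) <
      l 0 by omega)]
    rcases le_total (x i) (y j i) with h | h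
    · rw [max_eq_right (by linarith), max_eq_left (by linarith), abs_of_nonpos (by linarith)]
      ring
    · rw [max_eq_left (by linarith), max_eq_right (by linarith), abs_of_nonneg (by linarith)]
      ring
  -- the second layer
  set g : ℕ → ℝ := fun j => max (e j - u - Lip * ∑ i : Fin (l 0), |x i - y j i|) 0 with hg
  have layer2 : ∀ j < n, H 2 (2 + j) = g j := by
    intro j hj
    have := hlk 2 le_rfl (by omega)
    rw [step 1 (by omega) _ (show _ < l 2 by omega)]
    have hsum := sum_range_block (D := 2 * l 0) (by omega) hj hl1 (-Lip) (H 1)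
    rw [two_mul, Finset.sum_range_add, ← Finset.sum_add_distrib, ← two_mul,
      Finset.sum_range (n := l 0)] at hsum
    rw [Finset.sum_congr rfl (fun i _ => layer1 j hj i)] at hsum
    simp only [maxConvWeight, maxConvBias, one_ne_zero, if_false, if_true,
      if_neg (show ¬ 2 + j < 2 by omega), Nat.add_sub_cancel_left, hsum, hg]
    congr 1
    ring
  have layer2' : ∀ i < 2, H 2 i = 0 := by
    intro i hi
    have := hlk 2 le_rfl (by omega)
    rw [step 1 (by omega) _ (show _ < l 2 by omega)]
    simp [maxConvWeight, maxConvBias, hi]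
  -- the running maximum
  have hg0 : ∀ j, 0 ≤ g j := fun j => le_max_right _ _
  have row0 : ∀ k, 2 ≤ k → k < depth →
      ∑ j ∈ Finset.range (l k), maxConvWeight (l 0) n Lip k 0 j * H k j = H k 0 + H k 1 := by
    intro k hk hkd
    have := hlk k hk hkd
    rw [sum_range_mul_of_le_one (s := 1) (by omega), one_mul] <;>
      simp [maxConvWeight, show k ≠ 0 by omega, show k ≠ 1 by omega]
    exact fun j hj => hj
  -- Invariant: at layer `k` the cones with `j + 2 < k` have been absorbed. The next layer reads `g
  -- (k - 2)` from neuron `k`, or 0 once all cones are used up.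
  have main : ∀ k, 2 ≤ k → k < depth → (∀ j < n, H k (2 + j) = g j) ∧ 0 ≤ H k 0 + H k 1 ∧
      (∀ j < n, j + 2 < k → g j ≤ H k 0 + H k 1) ∧ H k 0 + H k 1 ≤ z - u := by
    intro k hk
    induction k, hk using Nat.le_induction with
    | base =>
      intro _
      rw [layer2' 0 (by omega), layer2' 1 (by omega)]
      exact ⟨layer2, by simp, fun j _ h => by omega, by linarith [hz.1]⟩
    | succ k hk ih =>
      intro hkd
      obtain ⟨ih1, ih2, ih3, ih4⟩ := ih (by omega)
      have hw := hlk k hk (by omega)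
      have hw' := hlk (k + 1) (by omega) hkd
      have hb : ∀ i, maxConvBias (l 0) depth u y e k i = 0 := by
        intro i
        simp [maxConvBias, show k ≠ 0 by omega, show k ≠ 1 by omega, hkd.ne]
      have c0 : H (k + 1) 0 = H k 0 + H k 1 := by
        rw [step k hkd 0 (by omega), row0 k hk (by omega), hb, add_zero, max_eq_left ih2]
      have c2 : ∀ j < n, H (k + 1) (2 + j) = g j := by
        intro j hj
        rw [step k hkd _ (by omega), hb, add_zero]
        simp [maxConvWeight, show k ≠ 0 by omega, show k ≠ 1 by omega, 
          show 2 + j ≠ 1 by omega, show 2 + j < l k by omega, ih1 j hj, hg0 j]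
      have c1 : H (k + 1) 1 =
          max ((if k < n + 2 then g (k - 2) else 0) - (H k 0 + H k 1)) 0 := by
        rw [step k hkd 1 (by omega), hb, add_zero]
        congr 1
        have hsplit : ∀ j, maxConvWeight (l 0) n Lip k 1 j * H k j
            = (if j ≤ 1 then -1 else 0) * H k j
              + (if j = k ∧ k < n + 2 then 1 else 0) * H k j := by
          intro j
          by_cases hj : j ≤ 1
          · simp [maxConvWeight, show k ≠ 0 by omega, show k ≠ 1 by omega, hj,
              show j ≠ k by omega]
          · simp [maxConvWeight, show k ≠ 0 by omega, show k ≠ 1 by omega, hj]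
        rw [Finset.sum_congr rfl (fun j _ => hsplit j), Finset.sum_add_distrib,
          sum_range_mul_of_le_one (s := -1) (by omega) (by simp) (by simp)
            (fun j hj => by simp; omega)]
        by_cases hkn : k < n + 2
        · have : H k k = g (k - 2) := by
            have := ih1 (k - 2) (by omega)
            rwa [show 2 + (k - 2) = k by omega] at this
          simp only [hkn, and_true, ite_mul, one_mul, zero_mul, Finset.sum_ite_eq',
            Finset.mem_range, if_true, show k < l k by omega, this]
          ring
        · simp [hkn]
      -- With `s` the old sum and `a` the new value, this is `s + max (a - s) 0 = max a s`.
      have hmax : H (k + 1) 0 + H (k + 1) 1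
          = max (if k < n + 2 then g (k - 2) else 0) (H k 0 + H k 1) := by
        rw [c0, c1, ← max_add_add_left]
        simp
      rw [hmax]
      refine ⟨c2, le_max_of_le_right ih2, ?_, max_le ?_ ih4⟩
      · intro j hj hjk
        rcases Nat.lt_succ_iff_lt_or_eq.1 hjk with h | h
        · exact le_max_of_le_right (ih3 j hj h)
        · refine le_max_of_le_left ?_
          rw [if_pos (by omega), show k - 2 = j by omega]
      · split_ifs with h
        · refine max_le ?_ (by linarith [hz.1])
          have := hez (k - 2) (by omega)
          linarith
        · linarith [hz.1]
  obtain ⟨k, rfl⟩ : ∃ k, depth = k + 1 := ⟨depth - 1, by omega⟩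
  obtain ⟨-, m2, m3, m4⟩ := main k (by omega) (by omega)
  -- Clipping is inactive, because the running maximum lies between 0 and `z - u ≤ v - u`.
  have hout : scalarNetwork rfl h1 u v θ x = u + (H k 0 + H k 1) := by
    have : scalarNetwork rfl h1 u v θ x = H (k + 1) 0 := by
      simp only [hH, neuron, h1, zero_lt_one, dif_pos]
      rfl
    rw [this, hH, neuron_succ (hθ k (by omega)) (by omega), if_neg (lt_irrefl _), ← hH,
      row0 k (by omega) (by omega), clipping_of_mem]
    · simp [maxConvBias, show k ≠ 0 by omega, show k ≠ 1 by omega]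
      ring
    · simp only [maxConvBias, show k ≠ 0 by omega, show k ≠ 1 by omega, if_false, if_true]
      exact ⟨by linarith, by linarith [hz.2]⟩
  rw [hout]
  refine ⟨fun j hj => ?_, by linarith⟩
  have := m3 j hj (by omega)
  have h2 : e j - u - Lip * ∑ i : Fin (l 0), |x i - y j i| ≤ g j := le_max_left _ _
  linarith

/-! ### Grids and approximation of Lipschitz functions -/

/-- The midpoint of the `t`-th of `n` intervals of equal length that cover `[a, b]`. -/
noncomputable def gridPoint (a b : ℝ) (n t : ℕ) : ℝ := a + (2 * t + 1) * ((b - a) / (2 * n))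

lemma gridPoint_mem {a b : ℝ} (hab : a ≤ b) {n t : ℕ} (ht : t < n) :
    gridPoint a b n t ∈ Set.Icc a b := by
  have hn : (0 : ℝ) < n := by exact_mod_cast (Nat.zero_le t).trans_lt ht
  have h0 : 0 ≤ (b - a) / (2 * n) := div_nonneg (by linarith) (by positivity)
  have h1 : 2 * n * ((b - a) / (2 * n)) = b - a := by field_simp
  have h2 : (t : ℝ) + 1 ≤ n := by exact_mod_cast ht
  unfold gridPoint
  constructor
  · have : 0 ≤ (2 * t + 1) * ((b - a) / (2 * n)) := by positivity
    linarith
  · nlinarith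

lemma exists_abs_sub_gridPoint_le {a b : ℝ} (hab : a < b) {n : ℕ} (hn : 1 ≤ n) {x : ℝ}
    (hx : x ∈ Set.Icc a b) :
    ∃ t : Fin n, |x - gridPoint a b n t| ≤ (b - a) / (2 * n) := by
  have hn' : (0 : ℝ) < n := by exact_mod_cast hn
  have h0 : 0 < (b - a) / (2 * n) := div_pos (by linarith) (by positivity)
  have h1 : 2 * n * ((b - a) / (2 * n)) = b - a := by field_simp
  unfold gridPoint
  set h := (b - a) / (2 * n) with hh
  have hq : 0 ≤ (x - a) / (2 * h) := div_nonneg (by linarith [hx.1]) (by positivity)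
  by_cases hs : ⌊(x - a) / (2 * h)⌋₊ < n
  · refine ⟨⟨_, hs⟩, ?_⟩
    have h2 := Nat.floor_le hq
    have h3 := Nat.lt_floor_add_one ((x - a) / (2 * h))
    rw [le_div_iff₀ (by positivity)] at h2
    rw [div_lt_iff₀ (by positivity)] at h3
    rw [abs_le]
    constructor <;> push_cast <;> nlinarith
  · have h2 : (n : ℝ) ≤ (x - a) / (2 * h) :=
      (Nat.cast_le.2 (not_lt.1 hs)).trans (Nat.floor_le hq)
    rw [le_div_iff₀ (by positivity)] at h2
    -- The floor reaches `n` only at the right endpoint, which belongs to the last interval.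
    refine ⟨⟨n - 1, by omega⟩, ?_⟩
    have h3 : ((n - 1 : ℕ) : ℝ) = n - 1 := by push_cast [hn]; ring
    simp only [h3]
    have h4 := hx.2
    rw [abs_le]
    constructor <;> nlinarith

lemma minDepthWidth_le_depth (l : ℕ → ℕ) (depth : ℕ) : minDepthWidth l depth ≤ depth :=
  Finset.min'_le _ _ (Finset.mem_insert_self _ _)

lemma minDepthWidth_le_width (l : ℕ → ℕ) {depth k : ℕ} (hk : 1 ≤ k) (hkd : k < depth) :
    minDepthWidth l depth ≤ l k :=
  Finset.min'_le _ _ (Finset.mem_insert_of_mem (Finset.mem_image_of_mem l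
    (Finset.mem_Ico.2 ⟨hk, hkd⟩)))

lemma one_le_minDepthWidth {l : ℕ → ℕ} {depth : ℕ} (hdepth : 1 ≤ depth)
    (hl : ∀ i ≤ depth, 1 ≤ l i) : 1 ≤ minDepthWidth l depth := by
  refine Finset.le_min' _ _ _ fun y hy => ?_
  rcases Finset.mem_insert.1 hy with rfl | hy
  · exact hdepth
  · obtain ⟨k, hk, rfl⟩ := Finset.mem_image.1 hy
    exact hl k (Finset.mem_Ico.1 hk).2.le

lemma abs_le_of_mem_Icc {a b c x : ℝ} (ha : |a| ≤ c) (hb : |b| ≤ c) (hx : x ∈ Set.Icc a b) :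
    |x| ≤ c :=
  abs_le.2 ⟨(abs_le.1 ha).1.trans hx.1, hx.2.trans (abs_le.1 hb).2⟩

lemma exists_scalarNetwork_eq_const {p depth d : ℕ} {l : ℕ → ℕ} (h0 : l 0 = d) (h1 : l depth = 1)
    (hdepth : 1 ≤ depth) (hp : numParams l depth ≤ p) {u v c e : ℝ} (hc : 0 ≤ c)
    (he : e ∈ Set.Icc u v) (hec : |e| ≤ c) :
    ∃ θ ∈ cube p (-c) c, ∀ x : Fin d → ℝ, scalarNetwork h0 h1 u v θ x = e := by
  subst h0
  obtain ⟨θ, hθc, hθ⟩ := exists_paramCoord_eq hp hc (fun _ _ _ => 0) (fun _ _ => e)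
    (by simpa using hc) (by simpa using hec)
  refine ⟨θ, hθc, fun x => ?_⟩
  obtain ⟨k, rfl⟩ : ∃ k, depth = k + 1 := ⟨depth - 1, by omega⟩
  have : scalarNetwork rfl h1 u v θ x = neuron θ l (k + 1) u v x (k + 1) 0 := by
    simp only [neuron, h1, zero_lt_one, dif_pos]
    rfl
  rw [this, neuron_succ (W := fun _ _ _ => 0) (β := fun _ _ => e) (hθ k (by omega)) (by omega),
    if_neg (lt_irrefl _)]
  simp [clipping_of_mem he]

/-- By the Lipschitz condition the cones with apexes on the graph of `E` stay below `E`, and the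
cone of a grid point at ℓ¹ distance `δ` from `x` is within `2 * Lip * δ` of `E x`. The width and
depth constraints limit the grid to about `r / 3` points per axis, where `r` is the `d`-th root of
`minDepthWidth`. -/
lemma exists_scalarNetwork_approx {p depth d : ℕ} {l : ℕ → ℕ} (h0 : l 0 = d) (h1 : l depth = 1)
    (hd : 1 ≤ d) (hdepth : 1 ≤ depth) (hl : ∀ i ≤ depth, 1 ≤ l i)
    (hp : numParams l depth ≤ p) {Lip a b u v c : ℝ} (hc : 1 ≤ c) (hLip0 : 0 ≤ Lip)
    (hLipc : Lip ≤ c) (hab : a < b) (ha : |a| ≤ c) (hb : |b| ≤ c)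
    (hu : 2 * |u| ≤ c) (hv : 2 * |v| ≤ c)
    {E : (Fin d → ℝ) → ℝ} (hE : ∀ x ∈ cube d a b, E x ∈ Set.Icc u v)
    (hLip : ∀ x ∈ cube d a b, ∀ y ∈ cube d a b, |E x - E y| ≤ Lip * ∑ i, |x i - y i|) :
    ∃ θ ∈ cube p (-c) c, ∀ x ∈ cube d a b, |scalarNetwork h0 h1 u v θ x - E x|
      ≤ 3 * d * Lip * (b - a) / (minDepthWidth l depth : ℝ) ^ (1 / (d : ℝ)) := by
  have hA1 := one_le_minDepthWidth hdepth hl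
  set A := minDepthWidth l depth with hA
  have hd0 : (0 : ℝ) < d := by exact_mod_cast hd
  have hApos : (0 : ℝ) < (A : ℝ) ^ (1 / (d : ℝ)) :=
    Real.rpow_pos_of_pos (by exact_mod_cast hA1) _
  have hu' : |u| ≤ c := by linarith [abs_nonneg u]
  have hv' : |v| ≤ c := by linarith [abs_nonneg v]
  have hvu : v - u ≤ c := by linarith [neg_abs_le u, le_abs_self v]
  set r := (A : ℝ) ^ (1 / (d : ℝ)) with hr
  have hdLip : 0 ≤ d * Lip * (b - a) := by
    have : 0 ≤ b - a := by linarith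
    positivity
  have hsum : ∀ {h : ℝ} {x y : Fin d → ℝ}, (∀ i, |x i - y i| ≤ h) →
      Lip * ∑ i, |x i - y i| ≤ Lip * (d * h) := by
    intro h x y hxy
    refine mul_le_mul_of_nonneg_left ?_ hLip0
    refine (Finset.sum_le_card_nsmul _ _ h fun i _ => hxy i).trans ?_
    simp
  -- For `r ≤ 6` the value at the centre of the cube suffices: its error is at most `d * Lip * (b -
  -- a) / 2`.
  rcases le_or_gt r 6 with h6 | h6
  · have hmid : (fun _ : Fin d => gridPoint a b 1 0) ∈ cube d a b :=
      ⟨fun i => (gridPoint_mem hab.le one_pos).1, fun i => (gridPoint_mem hab.le one_pos).2⟩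
    obtain ⟨θ, hθc, hθ⟩ := exists_scalarNetwork_eq_const h0 h1 hdepth hp (by linarith)
      (hE _ hmid) (abs_le_of_mem_Icc hu' hv' (hE _ hmid))
    refine ⟨θ, hθc, fun x hx => ?_⟩
    rw [hθ x, abs_sub_comm]
    refine (hLip x hx _ hmid).trans ((hsum (h := (b - a) / 2) fun i => ?_).trans ?_)
    · obtain ⟨t, ht⟩ := exists_abs_sub_gridPoint_le hab le_rfl ⟨hx.1 i, hx.2 i⟩
      have : t = 0 := Subsingleton.elim _ _
      subst this
      simpa using ht
    · rw [le_div_iff₀ hApos]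
      nlinarith
  -- Rounding up gives the constant 3 in the error, and `r > 6` still leaves `2 * m ≤ r`. Hence `2 *
  -- d * m ^ d ≤ (2 * m) ^ d ≤ A`, which provides the width of the first layer. Since `m ^ d ≥ 3`,
  -- also `m ^ d + 3 ≤ A`, which provides the depth.
  · obtain ⟨m, hm⟩ : ∃ m, m = ⌈r / 3⌉₊ := ⟨_, rfl⟩
    have hm1 : r / 3 ≤ m := hm ▸ Nat.le_ceil _
    have hm2 : (m : ℝ) < r / 3 + 1 := hm ▸ Nat.ceil_lt_add_one (by positivity)
    have hm3 : 3 ≤ m := by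
      have : (2 : ℝ) < m := by linarith
      exact_mod_cast this
    have hmA : (2 * m) ^ d ≤ A := by
      have h1 : (2 * m : ℝ) ≤ r := by linarith
      have h2 : (2 * m : ℝ) ^ d ≤ r ^ d := pow_le_pow_left₀ (by positivity) h1 d
      rw [hr, ← Real.rpow_natCast (_ ^ _), ← Real.rpow_mul (Nat.cast_nonneg A),
        one_div_mul_cancel hd0.ne', Real.rpow_one] at h2
      exact_mod_cast h2
    have h2d : ∀ k : ℕ, 1 ≤ k → 2 * k ≤ 2 ^ k := by
      intro k hk
      induction k, hk using Nat.le_induction with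
      | base => norm_num
      | succ k hk ih => rw [pow_succ]; omega
    have hnA : 2 * d * m ^ d ≤ A := by
      refine le_trans ?_ hmA
      rw [mul_pow]
      exact Nat.mul_le_mul_right _ (h2d d hd)
    have hn3 : 3 ≤ m ^ d := hm3.trans (Nat.le_self_pow (by omega) m)
    have hnA' : 2 * m ^ d ≤ A := by
      refine le_trans ?_ hnA
      exact Nat.mul_le_mul_right _ (by omega)
    have hAd := minDepthWidth_le_depth l depth
    have hAw : ∀ k, 1 ≤ k → k < depth → A ≤ l k := fun k hk hkd =>
      minDepthWidth_le_width l hk hkd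
    have hl1A := hAw 1 le_rfl (by omega)
    -- Enumeration of the multi-indices of the grid; the default 0 is a valid index, so every `f j`
    -- names a grid point.
    set f : ℕ → ℕ → ℕ := fun j i => if h : j < m ^ d ∧ i < d then
      (finFunctionFinEquiv.symm (⟨j, h.1⟩ : Fin (m ^ d)) ⟨i, h.2⟩ : Fin m) else 0 with hf
    have hfm : ∀ j i, f j i < m := by
      intro j i
      simp only [hf]
      split_ifs
      · exact Fin.is_lt _
      · omega
    have hy : ∀ j, (fun i : Fin d => gridPoint a b m (f j i)) ∈ cube d a b := fun j =>
      ⟨fun i => (gridPoint_mem hab.le (hfm j i)).1, fun i => (gridPoint_mem hab.le (hfm j i)).2⟩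
    subst h0
    obtain ⟨θ, hθc, hθ⟩ := exists_network_maxConv (n := m ^ l 0) h1 hp hd hc hLip0 hLipc hu' hvu
      (by omega) (hnA.trans hl1A)
      (fun k hk hkd => by have := hAw k (by omega) hkd; omega)
      (y := fun j i => gridPoint a b m (f j i))
      (fun j i => abs_le_of_mem_Icc ha hb (gridPoint_mem hab.le (hfm j i)))
      (e := fun j => E (fun i => gridPoint a b m (f j i))) (fun j => hE _ (hy j))
    refine ⟨θ, hθc, fun x hx => ?_⟩
    have hclose : ∀ j, |E x - E (fun i => gridPoint a b m (f j i))|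
        ≤ Lip * ∑ i : Fin (l 0), |x i - gridPoint a b m (f j i)| := fun j =>
      hLip x hx _ (hy j)
    obtain ⟨hlow, hup⟩ := hθ x (E x) (hE x hx) (fun j _ => by
      have := (abs_le.1 (hclose j)).1
      linarith)
    have hex : ∀ i, ∃ t : Fin m, |x i - gridPoint a b m t| ≤ (b - a) / (2 * m) := fun i =>
      exists_abs_sub_gridPoint_le hab (by omega) ⟨hx.1 i, hx.2 i⟩
    choose t ht using hex
    have hft : ∀ i : Fin (l 0), f (finFunctionFinEquiv t) i = t i := by
      intro i
      simp only [hf, Fin.is_lt, and_self, dif_pos, Fin.eta, Equiv.symm_apply_apply]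
    have hj := hlow _ (finFunctionFinEquiv t).is_lt
    have hd1 := hclose (finFunctionFinEquiv t)
    simp only [hft] at hj hd1
    have hd2 := hsum (h := (b - a) / (2 * m)) (x := x)
      (y := fun i => gridPoint a b m (t i)) (fun i => ht i)
    have hd3 := (abs_le.1 hd1).2
    have hmpos : (0 : ℝ) < m := by linarith
    have hfin : 2 * (Lip * (l 0 * ((b - a) / (2 * m)))) ≤ 3 * l 0 * Lip * (b - a) / r := by
      have : 2 * (Lip * (l 0 * ((b - a) / (2 * m)))) = l 0 * Lip * (b - a) / m := by
        field_simp
      rw [this, div_le_div_iff₀ hmpos hApos]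
      nlinarith
    rw [abs_le]
    constructor <;> linarith

/-! ### Concentration and uniform deviation of the empirical risk -/

/-- Hoeffding's lemma makes each centred summand sub-Gaussian with variance proxy `(D / 2) ^ 2`.
Independence adds the proxies, and the moment generating function of the sum is evaluated at `t /
M`. -/
lemma integral_exp_mul_mean_sub_le {Ω α : Type*} [MeasurableSpace Ω] [MeasurableSpace α]
    {P : Measure Ω} [IsProbabilityMeasure P] {M : ℕ} (hM : 1 ≤ M) {Z : ℕ → Ω → α}
    (hZ : IsIID P M Z) {φ : α → ℝ} (hφ : Measurable φ) {D : ℝ} (hD : 0 ≤ D)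
    (hφD : ∀ j ω, φ (Z j ω) ∈ Set.Icc 0 D) (t : ℝ) :
    Integrable (fun ω => Real.exp (t * (1 / (M : ℝ) * ∑ j ∈ Finset.Icc 1 M, φ (Z j ω)
      - ∫ ω', φ (Z 1 ω') ∂P))) P ∧
    ∫ ω, Real.exp (t * (1 / (M : ℝ) * ∑ j ∈ Finset.Icc 1 M, φ (Z j ω)
      - ∫ ω', φ (Z 1 ω') ∂P)) ∂P ≤ Real.exp (D ^ 2 * t ^ 2 / (8 * M)) := by
  obtain ⟨hmeas, hind, hid⟩ := hZ
  set m := ∫ ω', φ (Z 1 ω') ∂P with hm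
  have hM0 : (M : ℝ) ≠ 0 := by exact_mod_cast (by omega : M ≠ 0)
  have hsub : ∀ j ∈ (Finset.univ : Finset (Finset.Icc 1 M)),
      HasSubgaussianMGF (fun ω => φ (Z j ω) - m) ((‖D - 0‖₊ / 2) ^ 2) P := by
    intro j _
    have h1 : ∫ ω, φ (Z j ω) ∂P = m := ((hid j j.2).comp hφ).integral_eq
    have := hasSubgaussianMGF_of_mem_Icc (μ := P) (X := fun ω => φ (Z j ω))
      (hφ.comp (hmeas j j.2)).aemeasurable (Filter.Eventually.of_forall (hφD j))
    rwa [h1] at this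
  have hsum := HasSubgaussianMGF.sum_of_iIndepFun
    (hind.comp (fun _ x => φ x - m) (fun _ => hφ.sub_const m)) hsub
  have heq : ∀ ω, t / (M : ℝ) * ∑ j : Finset.Icc 1 M, (φ (Z j ω) - m)
      = t * (1 / (M : ℝ) * ∑ j ∈ Finset.Icc 1 M, φ (Z j ω) - m) := by
    intro ω
    rw [Finset.sum_sub_distrib, Finset.sum_coe_sort (Finset.Icc 1 M) (fun j => φ (Z j ω))]
    simp
    field_simp
  have h2 := hsum.mgf_le (t / M)
  have h3 := hsum.integrable_exp_mul (t / M)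
  simp only [Function.comp_apply, heq, mgf] at h2 h3
  refine ⟨h3, h2.trans (Real.exp_le_exp.2 (le_of_eq ?_))⟩
  simp
  rw [abs_of_nonneg hD]
  field_simp
  ring

/-- Maximal inequality: `t * |Δ i|` is at most the logarithm of the sum `F` of all exponentials.
Replacing `log F` by the tangent of the logarithm at `T`, a bound for the mean of `F`, yields an
explicit integrable majorant of mean at most `log T / t`. -/
lemma exists_integrable_bound_of_exp_moments {Ω ι : Type*} [MeasurableSpace Ω] [Fintype ι]
    [Nonempty ι] {P : Measure Ω} [IsProbabilityMeasure P] {Δ : ι → Ω → ℝ} {t κ : ℝ} (ht : 0 < t)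
    (hint : ∀ i, ∀ s ∈ ({t, -t} : Set ℝ), Integrable (fun ω => Real.exp (s * Δ i ω)) P ∧
      ∫ ω, Real.exp (s * Δ i ω) ∂P ≤ Real.exp κ) :
    ∃ H : Ω → ℝ, Integrable H P ∧ (∀ i ω, |Δ i ω| ≤ H ω) ∧
      ∫ ω, H ω ∂P ≤ (Real.log (2 * Fintype.card ι) + κ) / t := by
  have hn : (0 : ℝ) < Fintype.card ι := by exact_mod_cast Fintype.card_pos
  set T : ℝ := 2 * Fintype.card ι * Real.exp κ with hT
  have hT0 : 0 < T := by positivity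
  have hlogT : Real.log T = Real.log (2 * Fintype.card ι) + κ := by
    rw [hT, Real.log_mul (by positivity) (Real.exp_pos _).ne', Real.log_exp]
  set F : Ω → ℝ := fun ω => ∑ i, (Real.exp (t * Δ i ω) + Real.exp (-t * Δ i ω)) with hF
  have hsummand : ∀ i, Integrable (fun ω => Real.exp (t * Δ i ω) + Real.exp (-t * Δ i ω)) P :=
    fun i => (hint i t (by simp)).1.add (hint i (-t) (by simp)).1
  have hFint : Integrable F P := integrable_finsetSum _ fun i _ => hsummand i
  refine ⟨fun ω => (Real.log T - 1 + T⁻¹ * F ω) / t,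
    ((integrable_const _).add (hFint.const_mul _)).div_const _, ?_, ?_⟩
  · intro i ω
    rw [le_div_iff₀ ht]
    have h1 : Real.exp (t * |Δ i ω|) ≤ F ω := by
      refine le_trans ?_ (Finset.single_le_sum (fun j _ => by positivity) (Finset.mem_univ i))
      rcases abs_cases (Δ i ω) with ⟨h, -⟩ | ⟨h, -⟩ <;> rw [h]
      · linarith [Real.exp_pos (-t * Δ i ω)]
      · rw [mul_neg, ← neg_mul]
        linarith [Real.exp_pos (t * Δ i ω)]
    have h2 := Real.add_one_le_exp (t * |Δ i ω| - Real.log T)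
    rw [Real.exp_sub, Real.exp_log hT0] at h2
    have h3 : Real.exp (t * |Δ i ω|) / T ≤ T⁻¹ * F ω := by
      rw [div_eq_inv_mul]
      gcongr
    linarith
  · rw [integral_div, integral_add (integrable_const _) (hFint.const_mul _), integral_const_mul,
      ← hlogT]
    have h1 : ∫ ω, F ω ∂P ≤ T := by
      rw [hF, integral_finsetSum _ fun i _ => hsummand i]
      refine (Finset.sum_le_card_nsmul _ _ (2 * Real.exp κ) fun i _ => ?_).trans
        (le_of_eq (by simp [hT]; ring))
      rw [integral_add (hint i t (by simp)).1 (hint i (-t) (by simp)).1]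
      linarith [(hint i t (by simp)).2, (hint i (-t) (by simp)).2]
    have h2 : T⁻¹ * ∫ ω, F ω ∂P ≤ 1 := by
      rw [inv_mul_le_iff₀ hT0]; simpa using h1
    gcongr
    simp
    linarith

lemma abs_sq_sub_sq_le {u v x y z : ℝ} (hx : x ∈ Set.Icc u v) (hy : y ∈ Set.Icc u v)
    (hz : z ∈ Set.Icc u v) : |(|x - z| ^ 2 - |y - z| ^ 2)| ≤ 2 * (v - u) * |x - y| := by
  rw [sq_abs, sq_abs, show (x - z) ^ 2 - (y - z) ^ 2 = (x + y - 2 * z) * (x - y) by ring, abs_mul]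
  refine mul_le_mul_of_nonneg_right ?_ (abs_nonneg _)
  rw [abs_le]
  constructor <;> linarith [hx.1, hx.2, hy.1, hy.2, hz.1, hz.2]

lemma sq_abs_sub_mem {u v x z : ℝ} (hx : x ∈ Set.Icc u v) (hz : z ∈ Set.Icc u v) :
    |x - z| ^ 2 ∈ Set.Icc 0 ((v - u) ^ 2) := by
  refine ⟨by positivity, pow_le_pow_left₀ (abs_nonneg _) ?_ 2⟩
  rw [abs_le]
  constructor <;> linarith [hx.1, hx.2, hz.1, hz.2]

lemma abs_empiricalRisk_sub_le {d : ℕ} {f g : (Fin d → ℝ) → ℝ} {x : ℕ → Fin d → ℝ} {y : ℕ → ℝ}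
    {J : ℕ} (hJ : 1 ≤ J) {u v δ : ℝ} (huv : u ≤ v) (hf : ∀ j, f (x j) ∈ Set.Icc u v)
    (hg : ∀ j, g (x j) ∈ Set.Icc u v) (hy : ∀ j, y j ∈ Set.Icc u v)
    (hfg : ∀ j, |f (x j) - g (x j)| ≤ δ) :
    |empiricalRisk f x y J - empiricalRisk g x y J| ≤ 2 * (v - u) * δ := by
  have hJ0 : (0 : ℝ) < J := by exact_mod_cast hJ
  unfold empiricalRisk
  rw [← mul_sub, ← Finset.sum_sub_distrib, abs_mul, abs_of_nonneg (by positivity),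
    one_div_mul_eq_div, div_le_iff₀ hJ0]
  refine (Finset.abs_sum_le_sum_abs _ _).trans ?_
  refine (Finset.sum_le_card_nsmul _ _ (2 * (v - u) * δ) fun j _ => ?_).trans ?_
  · refine (abs_sq_sub_sq_le (hf j) (hg j) (hy j)).trans ?_
    have : 0 ≤ v - u := by linarith
    gcongr
    exact hfg j
  · simp [mul_comm]

lemma log_covering_number_le {L W M B c m : ℝ} {n q : ℕ} (hL : 1 ≤ L) (hLn : L = n) (hW : 2 ≤ W)
    (hM : 1 ≤ M) (hB : 1 ≤ B) (hc : 1 ≤ c) (hm1 : 1 ≤ m)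
    (hm : m ≤ 2 * (L * W ^ n * B ^ n * B * M)) (hq : q ≤ L * ((W - 1) * W)) :
    Real.log (2 * m ^ q) / (L * W) + L * W / 8 + 4 ≤ 9 * W ^ 2 * L * Real.log (3 * M * B * c) := by
  have hl2 : Real.log 2 ≤ 1 := by linarith [Real.log_two_lt_d9]
  have hlB := Real.log_nonneg hB
  have hlM := Real.log_nonneg hM
  have hlc := Real.log_nonneg hc
  have hlL := Real.log_le_sub_one_of_pos (by linarith : 0 < L)
  have hlW := Real.log_le_sub_one_of_pos (by linarith : 0 < W)
  have hell : Real.log (3 * M * B * c) = Real.log 3 + Real.log M + Real.log B + Real.log c := by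
    rw [Real.log_mul (by positivity) (by positivity), Real.log_mul (by positivity) (by positivity),
      Real.log_mul (by positivity) (by positivity)]
  have hl3 : 1 ≤ Real.log 3 := by
    rw [Real.le_log_iff_exp_le (by norm_num)]
    linarith [Real.exp_one_lt_d9]
  have hlm : Real.log m ≤ L * W + 2 * L * (Real.log B + Real.log M) := by
    refine (Real.log_le_log (by linarith) hm).trans ?_
    rw [Real.log_mul (by positivity) (by positivity), Real.log_mul (by positivity) (by positivity),
      Real.log_mul (by positivity) (by positivity), Real.log_mul (by positivity) (by positivity),
      Real.log_mul (by positivity) (by positivity), Real.log_pow, Real.log_pow, ← hLn]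
    have h1 : L * Real.log W ≤ L * (W - 1) := by gcongr
    have h2 : 1 * Real.log B ≤ L * Real.log B := by gcongr
    have h3 : 1 * Real.log M ≤ L * Real.log M := by gcongr
    have h4 : 0 ≤ L * Real.log M := by positivity
    linarith
  set ℓ := Real.log (3 * M * B * c) with hℓ
  have hℓ1 : 1 ≤ ℓ := by linarith
  have hlm' : Real.log m ≤ L * W + 2 * L * ℓ := by
    refine hlm.trans ?_
    gcongr
    linarith
  have hlogm : 0 ≤ Real.log m := Real.log_nonneg hm1
  have hLW : 0 < L * W := by positivity
  have h1 : Real.log (2 * m ^ q) / (L * W) ≤ 1 + (W - 1) * (L * W + 2 * L * ℓ) := by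
    rw [div_le_iff₀ hLW, Real.log_mul (by norm_num) (by positivity), Real.log_pow]
    have h2 : q * Real.log m ≤ (L * ((W - 1) * W)) * (L * W + 2 * L * ℓ) := by
      have : 0 ≤ W - 1 := by linarith
      gcongr
    have h3 : 1 ≤ L * W := by nlinarith
    nlinarith
  have hLW2 : 4 ≤ L * W ^ 2 := by nlinarith
  have hLW3 : L * W * 2 ≤ L * W ^ 2 := by nlinarith
  have h4 : L * W ^ 2 ≤ L * W ^ 2 * ℓ := le_mul_of_one_le_right (by positivity) hℓ1
  have h5 : L * W * 2 * ℓ ≤ L * W ^ 2 * ℓ := by gcongr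
  have h6 : 0 ≤ L * ℓ := by positivity
  nlinarith

lemma mem_cube_iff {n : ℕ} {a b : ℝ} {x : Fin n → ℝ} :
    x ∈ cube n a b ↔ ∀ i, x i ∈ Set.Icc a b :=
  ⟨fun h i => ⟨h.1 i, h.2 i⟩, fun h => ⟨fun i => (h i).1, fun i => (h i).2⟩⟩

/-- Uniform deviation of the empirical risk from the risk over all parameters of norm at most
`B`. -/
lemma exists_uniform_deviation_bound {Ω : Type*} [MeasurableSpace Ω] {P : Measure Ω}
    [IsProbabilityMeasure P] {p d depth M : ℕ} {l : ℕ → ℕ} (h0 : l 0 = d) (h1 : l depth = 1)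
    (hdepth : 1 ≤ depth) (hl : ∀ i ≤ depth, 1 ≤ l i) (hM : 1 ≤ M) {u v c B : ℝ} (huv : u ≤ v)
    (hc : 1 ≤ c) (hB : 1 ≤ B) {X : ℕ → Ω → Fin d → ℝ} {Y : ℕ → Ω → ℝ}
    (hX : ∀ j ω i, |X j ω i| ≤ B) (hY : ∀ j ω, Y j ω ∈ Set.Icc u v)
    (hXY : IsIID P M (fun j ω => (X j ω, Y j ω))) :
    ∃ H : Ω → ℝ, Integrable H P ∧
      (∀ ω, ∀ θ : Fin p → ℝ, ‖θ‖ ≤ B →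
        |empiricalRisk (scalarNetwork h0 h1 u v θ) (fun j => X j ω) (fun j => Y j ω) M
          - ∫ ω', |scalarNetwork h0 h1 u v θ (X 1 ω') - Y 1 ω'| ^ 2 ∂P| ≤ H ω) ∧
      ∫ ω, H ω ∂P ≤ 9 * max 1 (v - u) ^ 2 * ((maxWidth l depth : ℝ) + 1) ^ 2 * depth
        * Real.log (3 * M * B * c) / Real.sqrt M := by
  set L : ℝ := (depth : ℝ) with hLdef
  set W : ℝ := (maxWidth l depth : ℝ) + 1 with hWdef
  set D₀ : ℝ := max 1 (v - u) with hD₀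
  have hD1 : 1 ≤ D₀ := le_max_left _ _
  have hDv : v - u ≤ D₀ := le_max_right _ _
  have hvu : 0 ≤ v - u := by linarith
  have hL : 1 ≤ L := by rw [hLdef]; exact_mod_cast hdepth
  have hW : 2 ≤ W := by
    have : (1 : ℝ) ≤ maxWidth l depth := by
      exact_mod_cast (hl 0 (by omega)).trans (width_le_maxWidth (Nat.zero_le depth))
    linarith
  have hM1 : (1 : ℝ) ≤ M := by exact_mod_cast hM
  have hq : (numParams l depth : ℝ) ≤ L * ((W - 1) * W) := by
    have := numParams_le (l := l) (depth := depth) fun k hk => width_le_maxWidth hk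
    have : (numParams l depth : ℝ) ≤ depth * (maxWidth l depth * (maxWidth l depth + 1)) := by
      exact_mod_cast this
    rw [hWdef, add_sub_cancel_right]
    exact this
  set Λ : ℝ := L * W ^ depth * B ^ depth with hΛ
  have hΛ1 : 1 ≤ Λ := by
    have h1 : 1 ≤ W ^ depth := one_le_pow₀ (by linarith)
    have h2 : 1 ≤ B ^ depth := one_le_pow₀ hB
    exact one_le_mul_of_one_le_of_one_le (one_le_mul_of_one_le_of_one_le hL h1) h2
  have hΛBM : 1 ≤ Λ * B * M :=
    one_le_mul_of_one_le_of_one_le (one_le_mul_of_one_le_of_one_le hΛ1 hB) hM1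
  -- `Λ` is the Lipschitz constant of the network in its parameters. A grid of mesh radius `B / m`
  -- then moves network values by at most `1 / M`.
  obtain ⟨m, hm⟩ : ∃ m, m = ⌈Λ * B * M⌉₊ := ⟨_, rfl⟩
  have hmlow : Λ * B * M ≤ m := hm ▸ Nat.le_ceil _
  have hmup : (m : ℝ) ≤ 2 * (Λ * B * M) := by
    have : (m : ℝ) < Λ * B * M + 1 := hm ▸ Nat.ceil_lt_add_one (by linarith)
    linarith
  have hm1 : (1 : ℝ) ≤ m := by linarith
  have hmnat : 1 ≤ m := by exact_mod_cast hm1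
  -- the centers of the covering
  set q := numParams l depth with hqdef
  set η : (Fin q → Fin m) → Fin p → ℝ := fun f i =>
    if h : (i : ℕ) < q then gridPoint (-B) B m (f ⟨i, h⟩) else 0 with hη
  have hηB : ∀ f i, |η f i| ≤ B := by
    intro f i
    simp only [hη]
    split_ifs
    · exact abs_le.2 (gridPoint_mem (by linarith) (Fin.is_lt _))
    · simp; linarith
  have hcover : ∀ θ : Fin p → ℝ, ‖θ‖ ≤ B → ∃ f : Fin q → Fin m, ∀ i : Fin p, (i : ℕ) < q →
      |θ i - η f i| ≤ B / m := by
    intro θ hθ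
    have : ∀ k : Fin q, ∃ t : Fin m, ∀ i : Fin p, (i : ℕ) = k →
        |θ i - gridPoint (-B) B m t| ≤ B / m := by
      intro k
      by_cases hk : (k : ℕ) < p
      · obtain ⟨t, ht⟩ := exists_abs_sub_gridPoint_le (a := -B) (b := B) (by linarith) hmnat
          (x := θ ⟨k, hk⟩) (abs_le.1 ((norm_le_pi_norm θ _).trans hθ))
        refine ⟨t, fun i hi => ?_⟩
        have : i = ⟨k, hk⟩ := Fin.ext hi
        subst this
        refine ht.trans (le_of_eq ?_)
        rw [sub_neg_eq_add, ← two_mul, mul_div_mul_left _ _ two_ne_zero]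
      -- A required index beyond the available coordinates imposes no condition, so any cell serves.
      · exact ⟨⟨0, hmnat⟩, fun i hi => absurd i.2 (by omega)⟩
    choose f hf using this
    refine ⟨f, fun i hi => ?_⟩
    simp only [hη, hi, dif_pos]
    exact hf ⟨i, hi⟩ i rfl
  -- deviations at the centers
  set lam : ℝ := Real.sqrt M * (L * W) / D₀ ^ 2 with hlam
  have hsM : 0 < Real.sqrt M := Real.sqrt_pos.2 (by linarith)
  have hlam0 : 0 < lam := by positivity
  have : Nonempty (Fin q → Fin m) := ⟨fun _ => ⟨0, hmnat⟩⟩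
  have hmem : ∀ (θ : Fin p → ℝ) x, scalarNetwork h0 h1 u v θ x ∈ Set.Icc u v := fun θ x =>
    scalarNetwork_mem h0 h1 hdepth huv θ x
  have hNm : ∀ θ : Fin p → ℝ, Measurable (scalarNetwork h0 h1 u v θ) := fun θ =>
    ((continuous_scalarNetwork h0 h1 u v).comp (Continuous.prodMk_right θ)).measurable
  have hφ : ∀ θ : Fin p → ℝ, Measurable (fun z : (Fin d → ℝ) × ℝ =>
      |scalarNetwork h0 h1 u v θ z.1 - z.2| ^ 2) := fun θ =>
    (continuous_abs.measurable.comp (((hNm θ).comp measurable_fst).sub measurable_snd)).pow_const 2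
  have hexp := fun (f : Fin q → Fin m) (s : ℝ) =>
    integral_exp_mul_mean_sub_le hM hXY (hφ (η f)) (by positivity : 0 ≤ (v - u) ^ 2)
      (fun j ω => sq_abs_sub_mem (hmem _ _) (hY j ω)) s
  obtain ⟨H₀, hH₀int, hH₀, hH₀le⟩ := exists_integrable_bound_of_exp_moments (P := P)
    (Δ := fun (f : Fin q → Fin m) ω => empiricalRisk (scalarNetwork h0 h1 u v (η f))
      (fun j => X j ω) (fun j => Y j ω) M
        - ∫ ω', |scalarNetwork h0 h1 u v (η f) (X 1 ω') - Y 1 ω'| ^ 2 ∂P)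
    (t := lam) (κ := ((v - u) ^ 2) ^ 2 * lam ^ 2 / (8 * M)) hlam0 (by
      intro f s hs
      have hs2 : s ^ 2 = lam ^ 2 := by
        rcases hs with rfl | rfl
        · rfl
        · ring
      rw [← hs2]
      exact hexp f s)
  have hXm : Measurable (fun ω => (X 1 ω, Y 1 ω)) := hXY.1 1 (Finset.mem_Icc.2 ⟨le_rfl, hM⟩)
  have hint : ∀ θ : Fin p → ℝ,
      Integrable (fun ω => |scalarNetwork h0 h1 u v θ (X 1 ω) - Y 1 ω| ^ 2) P := fun θ =>
    Integrable.of_mem_Icc 0 ((v - u) ^ 2) ((hφ θ).comp hXm).aemeasurable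
      (Filter.Eventually.of_forall fun ω => sq_abs_sub_mem (hmem _ _) (hY 1 ω))
  have hΛm : Λ * (B / m) ≤ 1 / M := by
    rw [mul_div_assoc', div_le_div_iff₀ (by linarith) (by linarith)]
    linarith
  -- Passing to a center changes the empirical risk and the true risk by at most `2 * (v - u) / M`
  -- each.
  refine ⟨fun ω => H₀ ω + 4 * (v - u) / M, hH₀int.add (integrable_const _), ?_, ?_⟩
  · intro ω θ hθ
    obtain ⟨f, hf⟩ := hcover θ hθ
    have hdiff : ∀ j ω, |scalarNetwork h0 h1 u v θ (X j ω)
        - scalarNetwork h0 h1 u v (η f) (X j ω)| ≤ 1 / M := fun j ω =>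
      (abs_scalarNetwork_sub_le h0 h1 hB (by positivity)
        (fun i _ => (norm_le_pi_norm θ i).trans hθ) (fun i _ => hηB f i) hf (hX j ω)).trans hΛm
    have hA := abs_empiricalRisk_sub_le (x := fun j => X j ω) hM huv (fun _ => hmem θ _)
      (fun _ => hmem (η f) _) (fun j => hY j ω) (fun j => hdiff j ω)
    have hR : |∫ ω', |scalarNetwork h0 h1 u v θ (X 1 ω') - Y 1 ω'| ^ 2 ∂P
        - ∫ ω', |scalarNetwork h0 h1 u v (η f) (X 1 ω') - Y 1 ω'| ^ 2 ∂P|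
        ≤ 2 * (v - u) * (1 / M) := by
      rw [← integral_sub (hint θ) (hint (η f))]
      have := norm_integral_le_of_norm_le_const (μ := P) (C := 2 * (v - u) * (1 / M))
        (f := fun ω' => |scalarNetwork h0 h1 u v θ (X 1 ω') - Y 1 ω'| ^ 2
          - |scalarNetwork h0 h1 u v (η f) (X 1 ω') - Y 1 ω'| ^ 2)
        (Filter.Eventually.of_forall fun ω' => by
          refine (abs_sq_sub_sq_le (hmem _ _) (hmem _ _) (hY 1 ω')).trans ?_
          gcongr
          exact hdiff 1 ω')
      simpa using this
    have hC := hH₀ f ω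
    rw [abs_le] at hA hR hC ⊢
    have he : 4 * (v - u) / M = 2 * (2 * (v - u) * (1 / (M : ℝ))) := by ring
    simp only [he]
    constructor <;> linarith
  · rw [integral_add hH₀int (integrable_const _)]
    have hnum := log_covering_number_le (q := q) hL hLdef hW hM1 hB hc hm1 hmup hq
    have hsq : Real.sqrt M ^ 2 = M := Real.sq_sqrt (by linarith)
    have hcard : ((Fintype.card (Fin q → Fin m) : ℕ) : ℝ) = (m : ℝ) ^ q := by simp
    rw [hcard] at hH₀le
    have hlog : 0 ≤ Real.log (2 * (m : ℝ) ^ q) :=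
      Real.log_nonneg (by linarith [one_le_pow₀ hm1 (n := q)])
    have hLW : 0 < L * W := by positivity
    have hDsq : (v - u) ^ 2 ≤ D₀ ^ 2 := by gcongr
    have hb1 : (Real.log (2 * (m : ℝ) ^ q) + ((v - u) ^ 2) ^ 2 * lam ^ 2 / (8 * M)) / lam
        ≤ D₀ ^ 2 / Real.sqrt M * (Real.log (2 * (m : ℝ) ^ q) / (L * W) + L * W / 8) := by
      have hk : ((v - u) ^ 2) ^ 2 * lam ^ 2 / (8 * M) ≤ (D₀ ^ 2) ^ 2 * lam ^ 2 / (8 * M) := by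
        gcongr
      calc (Real.log (2 * (m : ℝ) ^ q) + ((v - u) ^ 2) ^ 2 * lam ^ 2 / (8 * M)) / lam
          ≤ (Real.log (2 * (m : ℝ) ^ q) + (D₀ ^ 2) ^ 2 * lam ^ 2 / (8 * M)) / lam := by gcongr
        _ = D₀ ^ 2 / Real.sqrt M * (Real.log (2 * (m : ℝ) ^ q) / (L * W) + L * W / 8) := by
            rw [hlam, ← hsq, Real.sqrt_sq hsM.le]
            field_simp
    have hb2 : 4 * (v - u) / M ≤ D₀ ^ 2 / Real.sqrt M * 4 := by
      rw [div_mul_eq_mul_div, div_le_div_iff₀ (by linarith) hsM]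
      have h2 : v - u ≤ D₀ ^ 2 := hDv.trans (le_self_pow₀ hD1 two_ne_zero)
      have h3 : Real.sqrt M ≤ M := by
        exact Real.sqrt_le_iff.2 ⟨by linarith, le_self_pow₀ hM1 two_ne_zero⟩
      calc 4 * (v - u) * Real.sqrt M ≤ 4 * D₀ ^ 2 * M := by gcongr
        _ = D₀ ^ 2 * 4 * M := by ring
    have hfin : D₀ ^ 2 / Real.sqrt M
        * (Real.log (2 * (m : ℝ) ^ q) / (L * W) + L * W / 8 + 4)
        ≤ D₀ ^ 2 / Real.sqrt M * (9 * W ^ 2 * L * Real.log (3 * M * B * c)) := by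
      gcongr
    have hrhs : D₀ ^ 2 / Real.sqrt M * (9 * W ^ 2 * L * Real.log (3 * M * B * c))
        = 9 * D₀ ^ 2 * W ^ 2 * L * Real.log (3 * M * B * c) / Real.sqrt M := by ring
    rw [← hrhs]
    refine le_trans ?_ hfin
    rw [mul_add]
    refine add_le_add (hH₀le.trans hb1) ?_
    simpa using hb2

/-! ### The closest of many uniform initialisations -/

/-- Gamma is convex and equals 1 at both 1 and 2. -/
lemma Gamma_one_add_le_one {s : ℝ} (h0 : 0 ≤ s) (h1 : s ≤ 1) : Real.Gamma (s + 1) ≤ 1 := by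
  have h := Real.convexOn_Gamma.2 (x := 1) (y := 2) (by simp) (by simp)
    (sub_nonneg.2 h1) h0 (by ring)
  simp only [smul_eq_mul, Real.Gamma_one, Real.Gamma_two] at h
  have h2 : (1 - s) * 1 + s * 2 = s + 1 := by ring
  rw [h2] at h
  linarith

lemma integral_exp_neg_mul_div_pow_le {K s : ℝ} (hK : 0 < K) (hs : 0 < s) {q : ℕ} (hq : 1 ≤ q) :
    IntegrableOn (fun t => Real.exp (-(K * (t / s) ^ q))) (Set.Ioi 0) ∧
    ∫ t in Set.Ioi (0 : ℝ), Real.exp (-(K * (t / s) ^ q)) ≤ s * K ^ (-(1 / (q : ℝ))) := by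
  have hq0 : (0 : ℝ) < q := by exact_mod_cast hq
  have hb : 0 < K / s ^ q := by positivity
  have hGpos : 0 < Real.Gamma (1 / (q : ℝ) + 1) := Real.Gamma_pos_of_pos (by positivity)
  have h := integral_exp_neg_mul_rpow hq0 hb
  have hfun : (fun t : ℝ => Real.exp (-(K / s ^ q) * t ^ (q : ℝ)))
      = fun t => Real.exp (-(K * (t / s) ^ q)) := by
    funext t
    rw [Real.rpow_natCast, div_pow]
    congr 1
    ring
  have hval : (K / s ^ q) ^ (-1 / (q : ℝ)) = s * K ^ (-(1 / (q : ℝ))) := by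
    rw [neg_div, Real.div_rpow hK.le (by positivity), ← Real.rpow_natCast,
      ← Real.rpow_mul hs.le, mul_neg, mul_one_div_cancel hq0.ne', Real.rpow_neg_one, div_inv_eq_mul,
      mul_comm]
  rw [hfun, hval] at h
  constructor
  -- The integral of a non-integrable function is 0 by convention, while the formula gives a
  -- positive value.
  · by_contra hni
    rw [integral_undef hni] at h
    have : 0 < s * K ^ (-(1 / (q : ℝ))) * Real.Gamma (1 / (q : ℝ) + 1) := by positivity
    linarith
  · rw [h]
    refine mul_le_of_le_one_right (by positivity) (Gamma_one_add_le_one (by positivity) ?_)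
    rw [div_le_one hq0]
    exact_mod_cast hq

lemma volume_cube_toReal {p : ℕ} {c : ℝ} (hc : 0 ≤ c) :
    (volume (cube p (-c) c)).toReal = (2 * c) ^ p := by
  unfold cube
  rw [Real.volume_Icc_pi_toReal fun _ => by linarith]
  simp [two_mul]

lemma IsUniform.real_preimage {Ω : Type*} [MeasurableSpace Ω] {P : Measure Ω}
    {p : ℕ} {c : ℝ} (hc : 0 < c) {Θ : Ω → Fin p → ℝ}
    (hunif : pdf.IsUniform Θ (cube p (-c) c) P volume) {A : Set (Fin p → ℝ)}
    (hA : MeasurableSet A) (hAc : A ⊆ cube p (-c) c) :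
    P.real (Θ ⁻¹' A) = (volume A).toReal / (2 * c) ^ p := by
  have h := volume_cube_toReal (p := p) hc.le
  have hpos : 0 < (2 * c) ^ p := by positivity
  have hne : volume (cube p (-c) c) ≠ 0 := fun h' => by
    rw [h'] at h; simp at h; linarith
  have htop : volume (cube p (-c) c) ≠ ⊤ := fun h' => by
    rw [h'] at h; simp at h; linarith
  rw [Measure.real, pdf.IsUniform.measure_preimage hne htop hunif hA, ENNReal.toReal_div, h,
    Set.inter_eq_self_of_subset_right hAc]

lemma measurableSet_cube {p : ℕ} {a b : ℝ} : MeasurableSet (cube p a b) := measurableSet_Icc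

/-- The maximum distance of the first `q` coordinates. -/
noncomputable def headDist {p : ℕ} (q : ℕ) (η θ : Fin p → ℝ) : ℝ :=
  ‖fun i : Fin p => if (i : ℕ) < q then θ i - η i else 0‖

lemma headDist_le_iff {p q : ℕ} {η θ : Fin p → ℝ} {t : ℝ} (ht : 0 ≤ t) :
    headDist q η θ ≤ t ↔ ∀ i : Fin p, (i : ℕ) < q → |θ i - η i| ≤ t := by
  unfold headDist
  rw [pi_norm_le_iff_of_nonneg ht]
  refine forall_congr' fun i => ?_
  by_cases h : (i : ℕ) < q <;> simp [h, ht]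

lemma headDist_nonneg {p q : ℕ} {η θ : Fin p → ℝ} : 0 ≤ headDist q η θ := norm_nonneg _

lemma measurable_headDist {p q : ℕ} (η : Fin p → ℝ) : Measurable (headDist q η) := by
  refine (continuous_norm.comp (continuous_pi fun i => ?_)).measurable
  split_ifs
  · exact (continuous_apply i).sub continuous_const
  · exact continuous_const

/-- For `t ≤ 2 * c` the cube contains a box that has side `t` in the first `q` coordinates and lies
within `t` of `η` there, even if `η` is a corner. Its probability is at least `(t / (2 * c)) ^ q`,
and `1 - x ≤ exp (-x)`. For larger `t` the whole cube serves. -/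
lemma real_lt_headDist_le {Ω : Type*} [MeasurableSpace Ω] {P : Measure Ω}
    [IsProbabilityMeasure P] {p q : ℕ} {c : ℝ} (hc : 0 < c) {Θ : Ω → Fin p → ℝ}
    (hΘ : Measurable Θ) (hunif : pdf.IsUniform Θ (cube p (-c) c) P volume) {η : Fin p → ℝ}
    (hη : η ∈ cube p (-c) c) {t : ℝ} (ht : 0 < t) :
    P.real (Θ ⁻¹' {θ | t < headDist q η θ}) ≤ Real.exp (-(t / (2 * c)) ^ q) := by
  rw [mem_cube_iff] at hη
  suffices h : ∃ A : Set (Fin p → ℝ), MeasurableSet A ∧ A ⊆ cube p (-c) c ∧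
      A ⊆ {θ | headDist q η θ ≤ t} ∧ 1 - Real.exp (-(t / (2 * c)) ^ q) ≤
        (volume A).toReal / (2 * c) ^ p by
    obtain ⟨A, hA, hAc, hAt, hvol⟩ := h
    rw [← IsUniform.real_preimage hc hunif hA hAc] at hvol
    have h1 : P.real (Θ ⁻¹' {θ | t < headDist q η θ}) ≤ P.real (Θ ⁻¹' A)ᶜ :=
      measureReal_mono fun ω hω hωA => by
        have h2 : headDist q η (Θ ω) ≤ t := hAt hωA
        have h3 : t < headDist q η (Θ ω) := hω
        linarith
    rw [probReal_compl_eq_one_sub (hΘ hA)] at h1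
    linarith
  rcases le_or_gt t (2 * c) with htc | htc
  · have hr1 : t / (2 * c) ≤ 1 := (div_le_one (by positivity)).2 htc
    set lo : Fin p → ℝ := fun i => if (i : ℕ) < q then max (-c) (η i - t) else -c with hlo
    set len : Fin p → ℝ := fun i => if (i : ℕ) < q then t else 2 * c with hlen
    have hlen0 : ∀ i, 0 ≤ len i := by
      intro i
      simp only [hlen]
      split_ifs <;> positivity
    refine ⟨Set.Icc lo (lo + len), measurableSet_Icc, ?_, ?_, ?_⟩
    · refine Set.Icc_subset_Icc (fun i => ?_) (fun i => ?_)
      · simp only [hlo]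
        split_ifs
        · exact le_max_left _ _
        · exact le_rfl
      · simp only [hlo, hlen, Pi.add_apply]
        split_ifs
        · rw [max_add]
          exact max_le (by linarith) (by linarith [(hη i).2])
        · linarith
    · intro θ hθ
      refine (headDist_le_iff ht.le).2 fun i hi => ?_
      have h1 := hθ.1 i
      have h2 := hθ.2 i
      simp only [hlo, hlen, Pi.add_apply, hi, if_true] at h1 h2
      have h3 : max (-c) (η i - t) ≤ η i := max_le (hη i).1 (by linarith)
      have h4 := le_max_right (-c) (η i - t)
      rw [abs_le]
      constructor <;> linarith
    · rw [Real.volume_Icc_pi_toReal fun i => by simp [hlen0 i]]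
      have hprod : (∏ i : Fin p, ((lo + len) i - lo i)) / (2 * c) ^ p
          = ∏ i : Fin p, (if (i : ℕ) < q then t / (2 * c) else 1) := by
        rw [← Fin.prod_const, ← Finset.prod_div_distrib]
        refine Finset.prod_congr rfl fun i _ => ?_
        simp only [Pi.add_apply, add_sub_cancel_left, hlen]
        split_ifs
        · rfl
        · exact div_self (by positivity)
      rw [hprod, Finset.prod_ite, Finset.prod_const, Finset.prod_const_one, mul_one]
      have hcard : (Finset.univ.filter fun i : Fin p => (i : ℕ) < q).card ≤ q := by
        have := Finset.card_le_card_of_injOn (s := Finset.univ.filter fun i : Fin p => (i : ℕ) < q)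
          (t := Finset.range q) (fun i => (i : ℕ)) (fun i hi => by simpa using hi)
          (fun i _ j _ hij => Fin.ext hij)
        simpa using this
      have h1 := pow_le_pow_of_le_one (by positivity) hr1 hcard
      have h2 := Real.add_one_le_exp (-(t / (2 * c)) ^ q)
      linarith
  · refine ⟨cube p (-c) c, measurableSet_cube, subset_rfl, ?_, ?_⟩
    · intro θ hθ
      rw [mem_cube_iff] at hθ
      refine (headDist_le_iff ht.le).2 fun i _ => ?_
      rw [abs_le]
      constructor <;> linarith [(hθ i).1, (hθ i).2, (hη i).1, (hη i).2]
    · rw [volume_cube_toReal hc.le, div_self (by positivity)]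
      linarith [Real.exp_pos (-(t / (2 * c)) ^ q)]

/-- The expected distance of a point to the closest of `K` independent uniformly distributed
random initialisations. -/
lemma exists_min_headDist_bound {Ω : Type*} [MeasurableSpace Ω] {P : Measure Ω}
    [IsProbabilityMeasure P] {p q K : ℕ} (hq : 1 ≤ q) (hK : 1 ≤ K) {c : ℝ} (hc : 0 < c)
    {Θ : ℕ → Ω → Fin p → ℝ} (hΘ : IsIID P K Θ)
    (hunif : pdf.IsUniform (Θ 1) (cube p (-c) c) P volume) {η : Fin p → ℝ}
    (hη : η ∈ cube p (-c) c) :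
    ∃ H : Ω → ℝ, Integrable H P ∧ (∀ ω, 0 ≤ H ω) ∧
      (∀ᵐ ω ∂P, ∃ k ∈ Set.Icc 1 K, Θ k ω ∈ cube p (-c) c ∧
        ∀ i : Fin p, (i : ℕ) < q → |Θ k ω i - η i| ≤ H ω) ∧
      ∫ ω, H ω ∂P ≤ 2 * c * (K : ℝ) ^ (-(1 / (q : ℝ))) := by
  obtain ⟨hmeas, hind, hid⟩ := hΘ
  have hne : (Finset.Icc 1 K).Nonempty := ⟨1, Finset.mem_Icc.2 ⟨le_rfl, hK⟩⟩
  set H : Ω → ℝ := fun ω => (Finset.Icc 1 K).inf' hne fun k => headDist q η (Θ k ω) with hH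
  have hHmeas : Measurable H := by
    have : Measurable ((Finset.Icc 1 K).inf' hne fun k ω => headDist q η (Θ k ω)) :=
      Finset.inf'_induction hne _ (fun _ h₁ _ h₂ => h₁.inf h₂)
        fun k hk => (measurable_headDist η).comp (hmeas k hk)
    convert this using 1
    funext ω
    simp [hH, Finset.inf'_apply]
  have hH0 : ∀ ω, 0 ≤ H ω := fun ω => Finset.le_inf' _ _ fun k _ => headDist_nonneg
  have hcube : ∀ᵐ ω ∂P, ∀ k ∈ Finset.Icc 1 K, Θ k ω ∈ cube p (-c) c := by
    refine (ae_ball_iff (Finset.Icc 1 K).countable_toSet).2 fun k hk => ?_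
    have h1 : P.real (Θ 1 ⁻¹' cube p (-c) c) = 1 := by
      rw [IsUniform.real_preimage hc hunif measurableSet_cube subset_rfl,
        volume_cube_toReal hc.le, div_self (by positivity)]
    have h2 : P (Θ k ⁻¹' cube p (-c) c) = 1 := by
      rw [(hid k hk).measure_mem_eq measurableSet_cube, ← ENNReal.toReal_eq_one_iff]
      exact h1
    exact (prob_compl_eq_zero_iff (hmeas k hk measurableSet_cube)).2 h2
  have hex : ∀ ω, ∃ k ∈ Finset.Icc 1 K, H ω = headDist q η (Θ k ω) := fun ω =>
    Finset.exists_mem_eq_inf' hne _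
  have hHb : ∀ᵐ ω ∂P, ∃ k ∈ Set.Icc 1 K, Θ k ω ∈ cube p (-c) c ∧
      ∀ i : Fin p, (i : ℕ) < q → |Θ k ω i - η i| ≤ H ω := by
    filter_upwards [hcube] with ω hω
    obtain ⟨k, hk, hHk⟩ := hex ω
    exact ⟨k, Finset.mem_Icc.1 hk, hω k hk, (headDist_le_iff (hH0 ω)).1 hHk.ge⟩
  have hHle : ∀ᵐ ω ∂P, H ω ∈ Set.Icc 0 (2 * c) := by
    filter_upwards [hcube] with ω hω
    refine ⟨hH0 ω, ?_⟩
    obtain ⟨k, hk, hHk⟩ := hex ω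
    rw [hHk]
    refine (headDist_le_iff (by positivity)).2 fun i _ => ?_
    have h1 := mem_cube_iff.1 (hω k hk) i
    have h2 := mem_cube_iff.1 hη i
    rw [abs_le]
    constructor <;> linarith [h1.1, h1.2, h2.1, h2.2]
  have hHint : Integrable H P := Integrable.of_mem_Icc 0 (2 * c) hHmeas.aemeasurable hHle
  refine ⟨H, hHint, hH0, hHb, ?_⟩
  have htail : ∀ t ∈ Set.Ioi (0 : ℝ),
      P.real {ω | t < H ω} ≤ Real.exp (-(K * (t / (2 * c)) ^ q)) := by
    intro t ht
    have hA : MeasurableSet {θ : Fin p → ℝ | t < headDist q η θ} :=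
      measurableSet_lt measurable_const (measurable_headDist η)
    have hset : {ω | t < H ω} = ⋂ k ∈ (Finset.univ : Finset (Finset.Icc 1 K)),
        Θ k ⁻¹' {θ | t < headDist q η θ} := by
      ext ω
      simp [hH, Finset.lt_inf'_iff]
    have hprod : P {ω | t < H ω} = ∏ k : Finset.Icc 1 K,
        P (Θ k ⁻¹' {θ | t < headDist q η θ}) := by
      rw [hset]
      exact hind.measure_inter_preimage_eq_mul Finset.univ fun _ _ => hA
    have hpow : P.real {ω | t < H ω} = P.real (Θ 1 ⁻¹' {θ | t < headDist q η θ}) ^ K := by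
      rw [Measure.real, hprod,
        Finset.prod_congr rfl fun (k : Finset.Icc 1 K) _ => (hid k k.2).measure_mem_eq hA]
      simp [Measure.real]
    rw [hpow]
    have h1 := pow_le_pow_left₀ measureReal_nonneg
      (real_lt_headDist_le (q := q) hc (hmeas 1 (Finset.mem_Icc.2 ⟨le_rfl, hK⟩)) hunif hη ht) K
    refine h1.trans (le_of_eq ?_)
    rw [← Real.exp_nat_mul]
    congr 1
    ring
  obtain ⟨hei, hele⟩ := integral_exp_neg_mul_div_pow_le (K := K) (s := 2 * c)
    (by exact_mod_cast hK) (by positivity) hq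
  -- Layer-cake formula; by independence the tail of the minimum is the `K`-th power of a single
  -- tail.
  rw [hHint.integral_eq_integral_meas_lt (Filter.Eventually.of_forall hH0)]
  refine le_trans ?_ hele
  refine integral_mono_of_nonneg (Filter.Eventually.of_forall fun t => measureReal_nonneg) hei ?_
  exact (ae_restrict_mem measurableSet_Ioi).mono htail

/-! ### The regression function and excess risk -/

/-- The componentwise projection onto the cube `[a, b]^n`. -/
noncomputable def cubeProj {n : ℕ} (a b : ℝ) (x : Fin n → ℝ) : Fin n → ℝ :=
  fun i => clipping a b (x i)

lemma cubeProj_mem {n : ℕ} {a b : ℝ} (hab : a ≤ b) (x : Fin n → ℝ) :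
    cubeProj a b x ∈ cube n a b :=
  mem_cube_iff.2 fun i => clipping_mem hab (x i)

lemma cubeProj_of_mem {n : ℕ} {a b : ℝ} {x : Fin n → ℝ} (hx : x ∈ cube n a b) :
    cubeProj a b x = x :=
  funext fun i => clipping_of_mem (mem_cube_iff.1 hx i)

/-- `E` is controlled only on the cube; composing with the projection gives a globally measurable
version that agrees with it there. -/
lemma continuous_comp_cubeProj {n : ℕ} {a b Lip : ℝ} (hab : a ≤ b) {E : (Fin n → ℝ) → ℝ}
    (hLip : ∀ x ∈ cube n a b, ∀ y ∈ cube n a b, |E x - E y| ≤ Lip * ∑ i, |x i - y i|) :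
    Continuous (fun x => E (cubeProj a b x)) := by
  have hp : Continuous (cubeProj a b : (Fin n → ℝ) → Fin n → ℝ) :=
    continuous_pi fun i => (continuous_clipping a b).comp (continuous_apply i)
  refine continuous_iff_continuousAt.2 fun x => ?_
  have hg : Continuous fun y : Fin n → ℝ =>
      Lip * ∑ i, |cubeProj a b y i - cubeProj a b x i| := by fun_prop
  refine tendsto_iff_dist_tendsto_zero.2 (squeeze_zero (fun _ => dist_nonneg)
    (fun y => hLip _ (cubeProj_mem hab y) _ (cubeProj_mem hab x)) ?_)
  have := hg.tendsto x
  simpa using this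

/-- In the expansion of the squares the cross term is the integral of `f(X) - E(X)` against `E(X) -
Y`. It vanishes because the first factor is measurable with respect to `X` and can be pulled out of
the conditional expectation. -/
lemma integral_sq_sub_eq_risk_sub_risk {Ω α : Type*} [MeasurableSpace Ω] [mα : MeasurableSpace α]
    {P : Measure Ω} [IsProbabilityMeasure P] {X : Ω → α} {Y : Ω → ℝ} (hX : Measurable X)
    (hY : Measurable Y) {u v : ℝ} (hYuv : ∀ ω, Y ω ∈ Set.Icc u v) {E f : α → ℝ}
    (hE : Measurable E) (hf : Measurable f) (hEuv : ∀ x, E x ∈ Set.Icc u v)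
    (hfuv : ∀ x, f x ∈ Set.Icc u v)
    (hcond : (fun ω => E (X ω)) =ᵐ[P] P[Y | MeasurableSpace.comap X mα]) :
    ∫ ω, |f (X ω) - E (X ω)| ^ 2 ∂P
      = ∫ ω, |f (X ω) - Y ω| ^ 2 ∂P - ∫ ω, |E (X ω) - Y ω| ^ 2 ∂P := by
  have hm : MeasurableSpace.comap X mα ≤ ‹MeasurableSpace Ω› := hX.comap_le
  have habs : ∀ {x y : ℝ}, x ∈ Set.Icc u v → y ∈ Set.Icc u v → |x - y| ≤ v - u := by
    intro x y hx hy
    rw [abs_le]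
    constructor <;> linarith [hx.1, hx.2, hy.1, hy.2]
  have hYint : Integrable Y P :=
    Integrable.of_mem_Icc u v hY.aemeasurable (Filter.Eventually.of_forall hYuv)
  have hEint : Integrable (fun ω => E (X ω)) P :=
    Integrable.of_mem_Icc u v (hE.comp hX).aemeasurable
      (Filter.Eventually.of_forall fun ω => hEuv _)
  set g : Ω → ℝ := fun ω => f (X ω) - E (X ω) with hg
  have hgm : Measurable g := (hf.comp hX).sub (hE.comp hX)
  have hgb : ∀ ω, |g ω| ≤ v - u := fun ω => habs (hfuv _) (hEuv _)
  have hgsm : StronglyMeasurable[MeasurableSpace.comap X mα] g :=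
    ((hf.sub hE).comp (comap_measurable X)).stronglyMeasurable
  have hgY : Integrable (g * Y) P :=
    hYint.bdd_mul hgm.aestronglyMeasurable (Filter.Eventually.of_forall hgb)
  have hgE : Integrable (fun ω => g ω * E (X ω)) P :=
    hEint.bdd_mul hgm.aestronglyMeasurable (Filter.Eventually.of_forall hgb)
  have horth : ∫ ω, g ω * Y ω ∂P = ∫ ω, g ω * E (X ω) ∂P := by
    have h1 := condExp_mul_of_stronglyMeasurable_left hgsm hgY hYint
    have h2 := integral_condExp hm (μ := P) (f := g * Y)
    have h3 : ∫ ω, g ω * Y ω ∂P = ∫ ω, (g * Y) ω ∂P := rfl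
    rw [h3, ← h2]
    refine integral_congr_ae ?_
    filter_upwards [h1, hcond] with ω h1 h2
    rw [h1, Pi.mul_apply, ← h2]
  have hsqint : ∀ {a b : Ω → ℝ}, Measurable a → Measurable b → (∀ ω, a ω ∈ Set.Icc u v) →
      (∀ ω, b ω ∈ Set.Icc u v) → Integrable (fun ω => |a ω - b ω| ^ 2) P :=
    fun ha hb hau hbu => Integrable.of_mem_Icc 0 ((v - u) ^ 2)
      ((continuous_abs.measurable.comp (ha.sub hb)).pow_const 2).aemeasurable
      (Filter.Eventually.of_forall fun ω => sq_abs_sub_mem (hau ω) (hbu ω))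
  have i1 : Integrable (fun ω => |f (X ω) - Y ω| ^ 2) P :=
    hsqint (hf.comp hX) hY (fun _ => hfuv _) hYuv
  have i2 : Integrable (fun ω => |E (X ω) - Y ω| ^ 2) P :=
    hsqint (hE.comp hX) hY (fun _ => hEuv _) hYuv
  have i3 : Integrable (fun ω => |f (X ω) - E (X ω)| ^ 2) P :=
    hsqint (hf.comp hX) (hE.comp hX) (fun _ => hfuv _) fun _ => hEuv _
  rw [← integral_sub i1 i2]
  have hzero : ∫ ω, (g ω * E (X ω) - g ω * Y ω) ∂P = 0 := by
    have := integral_sub hgE hgY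
    simp only [Pi.mul_apply] at this
    rw [this, horth, sub_self]
  have hexp : ∀ ω, |f (X ω) - Y ω| ^ 2 - |E (X ω) - Y ω| ^ 2
      = |f (X ω) - E (X ω)| ^ 2 + 2 * (g ω * E (X ω) - g ω * Y ω) := by
    intro ω
    simp only [sq_abs, hg]
    ring
  simp only [hexp]
  have i4 : Integrable (fun ω => 2 * (g ω * E (X ω) - g ω * Y ω)) P :=
    (hgE.sub hgY).const_mul 2
  rw [integral_add i3 i4, integral_const_mul, hzero, mul_zero, add_zero]

/-- A form of the Cauchy-Schwarz inequality for bounded functions on a product space. -/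
lemma integral_integral_le_of_sq_le {Ω α : Type*} [MeasurableSpace Ω] [MeasurableSpace α]
    {P : Measure Ω} [IsProbabilityMeasure P] {μ : Measure α} [IsProbabilityMeasure μ]
    {F : Ω → α → ℝ} (hF : Measurable (Function.uncurry F)) {D : ℝ}
    (hFD : ∀ ω x, F ω x ∈ Set.Icc 0 D) :
    Integrable (fun ω => ∫ x, F ω x ∂μ) P ∧ Integrable (fun ω => ∫ x, F ω x ^ 2 ∂μ) P ∧
    ∀ s : ℝ, 0 < s → ∫ ω, (∫ x, F ω x ^ 2 ∂μ) ∂P ≤ s ^ 2 →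
      ∫ ω, (∫ x, F ω x ∂μ) ∂P ≤ s := by
  have hint : Integrable (Function.uncurry F) (P.prod μ) :=
    Integrable.of_mem_Icc 0 D hF.aemeasurable (Filter.Eventually.of_forall fun z => hFD z.1 z.2)
  have hint2 : Integrable (fun z : Ω × α => F z.1 z.2 ^ 2) (P.prod μ) :=
    Integrable.of_mem_Icc 0 (D ^ 2) (hF.pow_const 2).aemeasurable
      (Filter.Eventually.of_forall fun z => ⟨sq_nonneg _,
        pow_le_pow_left₀ (hFD z.1 z.2).1 (hFD z.1 z.2).2 2⟩)
  have h1 : Integrable (fun ω => ∫ x, F ω x ∂μ) P := hint.integral_prod_left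
  have h2 : Integrable (fun ω => ∫ x, F ω x ^ 2 ∂μ) P := hint2.integral_prod_left
  refine ⟨h1, h2, fun s hs hle => ?_⟩
  have e1 : ∫ z, F z.1 z.2 ∂(P.prod μ) = ∫ ω, (∫ x, F ω x ∂μ) ∂P := integral_prod _ hint
  have e2 : ∫ z, F z.1 z.2 ^ 2 ∂(P.prod μ) = ∫ ω, (∫ x, F ω x ^ 2 ∂μ) ∂P := integral_prod _ hint2
  rw [← e1]
  rw [← e2] at hle
  -- The pointwise inequality `F ≤ F ^ 2 / (2 * s) + s / 2` integrates to the claim.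
  have hmono : ∫ z, F z.1 z.2 ∂(P.prod μ) ≤ ∫ z, (F z.1 z.2 ^ 2 / (2 * s) + s / 2) ∂(P.prod μ) := by
    refine integral_mono hint ((hint2.div_const _).add (integrable_const _)) fun z => ?_
    have : F z.1 z.2 ^ 2 / (2 * s) + s / 2 - F z.1 z.2 = (F z.1 z.2 - s) ^ 2 / (2 * s) := by
      field_simp
      ring
    have h3 : 0 ≤ (F z.1 z.2 - s) ^ 2 / (2 * s) := by positivity
    change F z.1 z.2 ≤ _
    linarith
  rw [integral_add (hint2.div_const _) (integrable_const _), integral_div] at hmono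
  have h4 : (∫ z, F z.1 z.2 ^ 2 ∂(P.prod μ)) / (2 * s) ≤ s ^ 2 / (2 * s) := by gcongr
  have h5 : s ^ 2 / (2 * s) = s / 2 := by field_simp
  simp at hmono
  linarith

/-! ### Arithmetic of the error terms -/

/-- Matches the optimisation and generalisation bounds with squares of terms of the final estimate.
The exponent of `K` comes from `1 / q ≥ 1 / (L * W ^ 2)`, halved by the square root. -/
lemma error_terms_sq {L W c D K M V ℓ : ℝ} {q n : ℕ} (hL : 1 ≤ L) (hW : 1 ≤ W) (hc : 1 ≤ c)
    (hV : 0 ≤ V) (hK : 1 ≤ K) (hM : 1 ≤ M) (hℓ : 0 ≤ ℓ) (hq : 1 ≤ q) (hqW : q ≤ L * W ^ 2) :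
    2 * V * (L * W ^ n * c ^ n) * (2 * c * K ^ (-(1 / (q : ℝ))))
      ≤ (2 * (V * L * W ^ n * c ^ (n + 1)) ^ (1 / 2 : ℝ)
          / K ^ ((2 * L)⁻¹ * (W ^ 2)⁻¹)) ^ 2 ∧
    2 * (9 * D ^ 2 * W ^ 2 * L * ℓ / Real.sqrt M)
      = (3 * D * W * (2 * L * ℓ) ^ (1 / 2 : ℝ) / M ^ (1 / 4 : ℝ)) ^ 2 := by
  constructor
  · rw [← Real.sqrt_eq_rpow, div_pow, mul_pow, Real.sq_sqrt (by positivity),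
      ← Real.rpow_natCast (K ^ _), ← Real.rpow_mul (by linarith),
      div_eq_mul_inv (2 ^ 2 * (V * L * W ^ n * c ^ (n + 1))), ← Real.rpow_neg (by linarith)]
    have hexp : -(1 / (q : ℝ)) ≤ -((2 * L)⁻¹ * (W ^ 2)⁻¹ * (2 : ℕ)) := by
      rw [neg_le_neg_iff]
      have : (2 * L)⁻¹ * (W ^ 2)⁻¹ * (2 : ℕ) = 1 / (L * W ^ 2) := by
        push_cast
        field_simp
      rw [this]
      exact one_div_le_one_div_of_le (by exact_mod_cast hq) hqW
    have h1 := Real.rpow_le_rpow_of_exponent_le hK hexp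
    have h2 : 2 * V * (L * W ^ n * c ^ n) * (2 * c * K ^ (-(1 / (q : ℝ))))
        = 2 ^ 2 * (V * L * W ^ n * c ^ (n + 1)) * K ^ (-(1 / (q : ℝ))) := by ring
    rw [h2]
    gcongr
  · rw [← Real.sqrt_eq_rpow, div_pow, mul_pow _ (Real.sqrt (2 * L * ℓ)),
      Real.sq_sqrt (by positivity), ← Real.rpow_natCast (M ^ _), ← Real.rpow_mul (by linarith),
      Real.sqrt_eq_rpow]
    norm_num
    ring

lemma error_terms_le {d L W c B a b u v Lip A K M e : ℝ} {n : ℕ} (hd : 0 ≤ d) (hL : 1 ≤ L)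
    (hW : 1 ≤ W) (hc : 1 ≤ c) (hcB : c ≤ B) (hab : b - a ≤ 2 * c) (hab0 : 0 ≤ b - a)
    (hLip : Lip ≤ c) (huv : v - u ≤ c) (hA : 0 < A)
    (hK : 0 < K) (hM : 1 ≤ M) :
    2 * ((v - u) * L * W ^ n * c ^ (n + 1)) ^ (1 / 2 : ℝ) / K ^ e
        + 3 * d * Lip * (b - a) / A
        + 3 * max 1 (v - u) * W * (2 * L * Real.log (3 * M * B * c)) ^ (1 / 2 : ℝ)
          / M ^ (1 / 4 : ℝ)
      ≤ 6 * d * c ^ 2 / A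
        + 5 * B ^ 2 * L * W * Real.log (Real.exp 1 * M) / M ^ (1 / 4 : ℝ)
        + 2 * L * W ^ n * c ^ (n + 1) / K ^ e := by
  have hB : 1 ≤ B := hc.trans hcB
  have hKe : 0 < K ^ e := Real.rpow_pos_of_pos hK e
  have hMe : 0 < M ^ (1 / 4 : ℝ) := Real.rpow_pos_of_pos (by linarith) _
  have hlM : 0 ≤ Real.log M := Real.log_nonneg hM
  have t1 : 2 * ((v - u) * L * W ^ n * c ^ (n + 1)) ^ (1 / 2 : ℝ) / K ^ e
      ≤ 2 * L * W ^ n * c ^ (n + 1) / K ^ e := by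
    rw [← Real.sqrt_eq_rpow]
    refine div_le_div_of_nonneg_right ?_ hKe.le
    have h1 : (v - u) ≤ L * W ^ n * c ^ (n + 1) := by
      refine huv.trans ?_
      have h2 : 1 ≤ L * W ^ n := one_le_mul_of_one_le_of_one_le hL (one_le_pow₀ hW)
      calc c ≤ c ^ (n + 1) := le_self_pow₀ hc (by omega)
        _ ≤ L * W ^ n * c ^ (n + 1) := le_mul_of_one_le_left (by positivity) h2
    have h3 : Real.sqrt ((v - u) * L * W ^ n * c ^ (n + 1)) ≤ L * W ^ n * c ^ (n + 1) := by
      rw [Real.sqrt_le_left (by positivity)]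
      calc (v - u) * L * W ^ n * c ^ (n + 1) = (v - u) * (L * W ^ n * c ^ (n + 1)) := by ring
        _ ≤ (L * W ^ n * c ^ (n + 1)) * (L * W ^ n * c ^ (n + 1)) := by gcongr
        _ = (L * W ^ n * c ^ (n + 1)) ^ 2 := by ring
    linarith
  have t2 : 3 * d * Lip * (b - a) / A ≤ 6 * d * c ^ 2 / A := by
    refine div_le_div_of_nonneg_right ?_ hA.le
    calc 3 * d * Lip * (b - a) ≤ 3 * d * c * (2 * c) := by gcongr
      _ = 6 * d * c ^ 2 := by ring
  have t3 : 3 * max 1 (v - u) * W * (2 * L * Real.log (3 * M * B * c)) ^ (1 / 2 : ℝ)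
          / M ^ (1 / 4 : ℝ)
      ≤ 5 * B ^ 2 * L * W * Real.log (Real.exp 1 * M) / M ^ (1 / 4 : ℝ) := by
    refine div_le_div_of_nonneg_right ?_ hMe.le
    rw [← Real.sqrt_eq_rpow, Real.log_mul (Real.exp_pos 1).ne' (by positivity), Real.log_exp]
    have hD : max 1 (v - u) ≤ B := max_le hB (huv.trans hcB)
    have hlog : Real.log (3 * M * B * c) ≤ 1 / 10 + B ^ 2 + Real.log M := by
      have h1 : Real.log (3 * M * B * c) ≤ Real.log (3 * M * B ^ 2) := by
        refine Real.log_le_log (by positivity) ?_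
        calc 3 * M * B * c ≤ 3 * M * B * B := by gcongr
          _ = 3 * M * B ^ 2 := by ring
      have h0 : Real.log (3 * M * B ^ 2) = Real.log 3 + Real.log M + Real.log (B ^ 2) := by
        rw [Real.log_mul (by positivity) (by positivity),
          Real.log_mul (by positivity) (by positivity)]
      rw [h0] at h1
      have h2 := Real.log_le_sub_one_of_pos (by positivity : 0 < B ^ 2)
      -- Numerically, `3 ^ 10 = 59049` is below `exp 11`.
      have h3 : Real.log 3 ≤ 11 / 10 := by
        have : Real.log (3 ^ 10) ≤ Real.log (Real.exp 1 ^ 11) := by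
          refine Real.log_le_log (by norm_num) ?_
          refine le_trans ?_ (pow_le_pow_left₀ (by norm_num) Real.exp_one_gt_d9.le 11)
          norm_num
        rw [Real.log_pow, ← Real.exp_nat_mul, Real.log_exp] at this
        norm_num at this
        linarith
      linarith
    have hsqrt : 3 * Real.sqrt (2 * L * Real.log (3 * M * B * c))
        ≤ 5 * B * L * (1 + Real.log M) := by
      have hr : 0 ≤ 5 * B * L * (1 + Real.log M) / 3 := by positivity
      have : Real.sqrt (2 * L * Real.log (3 * M * B * c)) ≤ 5 * B * L * (1 + Real.log M) / 3 := by
        rw [Real.sqrt_le_left hr]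
        have h1 : 18 * (1 / 10 + B ^ 2 + Real.log M) ≤ 25 * B ^ 2 * (1 + Real.log M) ^ 2 := by
          have hB2 : 1 ≤ B ^ 2 := one_le_pow₀ hB
          have h2 : Real.log M ≤ B ^ 2 * Real.log M := le_mul_of_one_le_left hlM hB2
          nlinarith [mul_nonneg (sq_nonneg B) (sq_nonneg (Real.log M))]
        have hLL : L ≤ L ^ 2 := le_self_pow₀ hL two_ne_zero
        have h3 : 18 * L * Real.log (3 * M * B * c)
            ≤ L ^ 2 * (25 * B ^ 2 * (1 + Real.log M) ^ 2) := by
          calc 18 * L * Real.log (3 * M * B * c)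
              ≤ 18 * L * (1 / 10 + B ^ 2 + Real.log M) := by gcongr
            _ = L * (18 * (1 / 10 + B ^ 2 + Real.log M)) := by ring
            _ ≤ L ^ 2 * (25 * B ^ 2 * (1 + Real.log M) ^ 2) := by gcongr
        linarith
      linarith
    calc 3 * max 1 (v - u) * W * Real.sqrt (2 * L * Real.log (3 * M * B * c))
        = max 1 (v - u) * W * (3 * Real.sqrt (2 * L * Real.log (3 * M * B * c))) := by ring
      _ ≤ B * W * (5 * B * L * (1 + Real.log M)) := by gcongr
      _ = 5 * B ^ 2 * L * W * (1 + Real.log M) := by ring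
  linarith

lemma sq_add_sq_add_sq_le {x y z : ℝ} (hx : 0 ≤ x) (hy : 0 ≤ y) (hz : 0 ≤ z) :
    x ^ 2 + y ^ 2 + z ^ 2 ≤ (z + y + x) ^ 2 := by
  nlinarith [mul_nonneg hx hy, mul_nonneg hx hz, mul_nonneg hy hz]

/-! ### The main theorem -/

/-- Here `p` is the number of parameters, `Lip` the Lipschitz constant, `S` the set of admissible
SGD step indices. The norm on `Fin p → ℝ` is the maximum norm. -/
theorem corollary5p9
    (d p depth M K N : ℕ) (hd : 1 ≤ d) (hp : 1 ≤ p) (hdepth : 1 ≤ depth)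
    (hM : 1 ≤ M) (hK : 1 ≤ K) (hN : 1 ≤ N)
    (Lip a u b v c B : ℝ) (hab : a < b) (huv : u < v)
    (hc : max 1 (max Lip (max |a| (max |b| (max (2 * |u|) (2 * |v|))))) ≤ c) (hcB : c ≤ B)
    (l : ℕ → ℕ) (hl : ∀ i ≤ depth, 1 ≤ l i)
    (S : Set ℕ) (hS : ∀ m ∈ S, m ≤ N) (hS0 : 0 ∈ S)
    (J : ℕ → ℕ) (hJ : ∀ n, 1 ≤ n → 1 ≤ J n) (γ : ℕ → ℝ)
    (hl0 : l 0 = d) (hl1 : l depth = 1) (hparams : numParams l depth ≤ p)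
    {Ω : Type*} [MeasurableSpace Ω] (P : Measure Ω) [IsProbabilityMeasure P]
    (X : ℕ → ℕ → ℕ → Ω → (Fin d → ℝ)) (hX : ∀ k n j ω, X k n j ω ∈ cube d a b)
    (Y : ℕ → ℕ → ℕ → Ω → ℝ) (hY : ∀ k n j ω, Y k n j ω ∈ Set.Icc u v)
    (hXY : IsIID P M (fun j ω => (X 0 0 j ω, Y 0 0 j ω)))
    (E : (Fin d → ℝ) → ℝ) (hE : ∀ x ∈ cube d a b, E x ∈ Set.Icc u v)
    (hcond : (fun ω => E (X 0 0 1 ω)) =ᵐ[P]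
      P[Y 0 0 1 | MeasurableSpace.comap (X 0 0 1) MeasurableSpace.pi])
    (hLip : ∀ x ∈ cube d a b, ∀ y ∈ cube d a b, |E x - E y| ≤ Lip * ∑ i, |x i - y i|)
    (Θ : ℕ → ℕ → Ω → (Fin p → ℝ)) (hΘ : ∀ k n, Measurable (Θ k n))
    (kk : Ω → ℕ × ℕ) (hkk : Measurable kk)
    (hΘB : ∀ k, 1 ≤ k → ∀ ω, Θ k 0 ω ∈ cube p (-B) B)
    (hΘiid : IsIID P K (fun k => Θ k 0))
    (hΘunif : pdf.IsUniform (Θ 1 0) (cube p (-c) c) P volume)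
    (G : ℕ → ℕ → (Fin p → ℝ) → Ω → (Fin p → ℝ))
    (hG : ∀ k n, 1 ≤ k → 1 ≤ n → ∀ ω θ,
      DifferentiableAt ℝ (fun η : Fin p → ℝ => empiricalRisk (scalarNetwork hl0 hl1 u v η)
        (fun j => X k n j ω) (fun j => Y k n j ω) (J n)) θ →
      G k n θ ω = gradVec (fun η : Fin p → ℝ => empiricalRisk (scalarNetwork hl0 hl1 u v η)
        (fun j => X k n j ω) (fun j => Y k n j ω) (J n)) θ)
    (hSGD : ∀ k n, 1 ≤ k → 1 ≤ n → ∀ ω,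
      Θ k n ω = Θ k (n - 1) ω - γ n • G k n (Θ k (n - 1) ω) ω)
    (hargmin : ∀ ω, kk ω ∈ argminOver
      {q : ℕ × ℕ | q.1 ∈ Set.Icc 1 K ∧ q.2 ∈ S ∧ ‖Θ q.1 q.2 ω‖ ≤ B}
      (fun q => empiricalRisk (scalarNetwork hl0 hl1 u v (Θ q.1 q.2 ω))
        (fun j => X 0 0 j ω) (fun j => Y 0 0 j ω) M)) :
    -- the expectation and the integral below are well defined
    Measurable (fun z : Ω × cube d a b =>
      |scalarNetwork hl0 hl1 u v (Θ (kk z.1).1 (kk z.1).2 z.1) (z.2 : Fin d → ℝ) - E z.2|) ∧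
    (∀ ω, IntegrableOn
      (fun x => |scalarNetwork hl0 hl1 u v (Θ (kk ω).1 (kk ω).2 ω) x - E x|)
      (cube d a b) (P.map (X 0 0 1))) ∧
    Integrable (fun ω => ∫ x in cube d a b,
      |scalarNetwork hl0 hl1 u v (Θ (kk ω).1 (kk ω).2 ω) x - E x| ∂(P.map (X 0 0 1))) P ∧
    -- the first estimate
    ∫ ω, (∫ x in cube d a b,
        |scalarNetwork hl0 hl1 u v (Θ (kk ω).1 (kk ω).2 ω) x - E x| ∂(P.map (X 0 0 1))) ∂P
      ≤ 2 * ((v - u) * depth * ((maxWidth l depth : ℝ) + 1) ^ depth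
            * c ^ (depth + 1)) ^ (1 / 2 : ℝ)
          / (K : ℝ) ^ ((2 * (depth : ℝ))⁻¹ * (((maxWidth l depth : ℝ) + 1) ^ 2)⁻¹)
        + 3 * d * Lip * (b - a) / (minDepthWidth l depth : ℝ) ^ (1 / (d : ℝ))
        + 3 * max 1 (v - u) * ((maxWidth l depth : ℝ) + 1)
            * (2 * (depth : ℝ) * Real.log (3 * M * B * c)) ^ (1 / 2 : ℝ)
          / (M : ℝ) ^ (1 / 4 : ℝ) ∧
    -- the second estimate
    2 * ((v - u) * depth * ((maxWidth l depth : ℝ) + 1) ^ depth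
            * c ^ (depth + 1)) ^ (1 / 2 : ℝ)
          / (K : ℝ) ^ ((2 * (depth : ℝ))⁻¹ * (((maxWidth l depth : ℝ) + 1) ^ 2)⁻¹)
        + 3 * d * Lip * (b - a) / (minDepthWidth l depth : ℝ) ^ (1 / (d : ℝ))
        + 3 * max 1 (v - u) * ((maxWidth l depth : ℝ) + 1)
            * (2 * (depth : ℝ) * Real.log (3 * M * B * c)) ^ (1 / 2 : ℝ)
          / (M : ℝ) ^ (1 / 4 : ℝ)
      ≤ 6 * d * c ^ 2 / (minDepthWidth l depth : ℝ) ^ (1 / (d : ℝ))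
        + 5 * B ^ 2 * depth * ((maxWidth l depth : ℝ) + 1) * Real.log (Real.exp 1 * M)
          / (M : ℝ) ^ (1 / 4 : ℝ)
        + 2 * depth * ((maxWidth l depth : ℝ) + 1) ^ depth * c ^ (depth + 1)
          / (K : ℝ) ^ ((2 * (depth : ℝ))⁻¹ * (((maxWidth l depth : ℝ) + 1) ^ 2)⁻¹) := by
  simp only [max_le_iff] at hc
  obtain ⟨hc1, hLipc, hac, hbc, huc, hvc⟩ := hc
  have hB1 : 1 ≤ B := hc1.trans hcB
  have hvu : v - u ≤ c := by linarith [neg_abs_le u, le_abs_self v, abs_nonneg u, abs_nonneg v]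
  have hba : b - a ≤ 2 * c := by linarith [neg_abs_le a, le_abs_self b]
  have hd0 : (0 : ℝ) < d := by exact_mod_cast hd
  have hM1 : (1 : ℝ) ≤ M := by exact_mod_cast hM
  have hK1 : (1 : ℝ) ≤ K := by exact_mod_cast hK
  have hL1 : (1 : ℝ) ≤ depth := by exact_mod_cast hdepth
  have hW1 : (1 : ℝ) ≤ (maxWidth l depth : ℝ) + 1 := by
    linarith [(Nat.cast_nonneg (maxWidth l depth) : (0 : ℝ) ≤ _)]
  -- Two opposite corners of the cube have positive distance, which forces the sign of `Lip`.
  have hLip0 : 0 ≤ Lip := by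
    have h := (abs_nonneg _).trans (hLip (fun _ => b)
      (mem_cube_iff.2 fun _ => ⟨hab.le, le_rfl⟩) (fun _ => a)
      (mem_cube_iff.2 fun _ => ⟨le_rfl, hab.le⟩))
    simp only [Finset.sum_const, Finset.card_univ, Fintype.card_fin, nsmul_eq_mul] at h
    have h2 : 0 < (d : ℝ) * |b - a| := mul_pos hd0 (abs_pos.2 (by linarith))
    exact nonneg_of_mul_nonneg_left h h2
  have hA1 := one_le_minDepthWidth hdepth hl
  have hApos : (0 : ℝ) < (minDepthWidth l depth : ℝ) ^ (1 / (d : ℝ)) :=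
    Real.rpow_pos_of_pos (by exact_mod_cast hA1) _
  have h1M : 1 ∈ Finset.Icc 1 M := Finset.mem_Icc.2 ⟨le_rfl, hM⟩
  have hX1 : Measurable (X 0 0 1) := measurable_fst.comp (hXY.1 1 h1M)
  have hY1 : Measurable (Y 0 0 1) := measurable_snd.comp (hXY.1 1 h1M)
  -- the globally defined version of the regression function
  set E' : (Fin d → ℝ) → ℝ := fun x => E (cubeProj a b x) with hE'
  have hE'E : ∀ x ∈ cube d a b, E x = E' x := fun x hx => by
    simp only [hE', cubeProj_of_mem hx]
  have hE'm : Measurable E' := (continuous_comp_cubeProj hab.le hLip).measurable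
  have hE'uv : ∀ x, E' x ∈ Set.Icc u v := fun x => hE _ (cubeProj_mem hab.le x)
  -- the trained network
  set T : Ω → Fin p → ℝ := fun ω => Θ (kk ω).1 (kk ω).2 ω with hT
  have hTm : Measurable T := by
    have h : Measurable (fun z : (ℕ × ℕ) × Ω => Θ z.1.1 z.1.2 z.2) :=
      measurable_from_prod_countable_right fun q => hΘ q.1 q.2
    exact h.comp (hkk.prodMk measurable_id)
  have hmem : ∀ (θ : Fin p → ℝ) x, scalarNetwork hl0 hl1 u v θ x ∈ Set.Icc u v := fun θ x =>
    scalarNetwork_mem hl0 hl1 hdepth huv.le θ x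
  have hNm : ∀ θ : Fin p → ℝ, Measurable (scalarNetwork hl0 hl1 u v θ) := fun θ =>
    ((continuous_scalarNetwork hl0 hl1 u v).comp (Continuous.prodMk_right θ)).measurable
  set F : Ω → (Fin d → ℝ) → ℝ := fun ω x => |scalarNetwork hl0 hl1 u v (T ω) x - E' x| with hF
  have hFm : Measurable (Function.uncurry F) := by
    have h1 : Measurable (fun z : Ω × (Fin d → ℝ) => scalarNetwork hl0 hl1 u v (T z.1) z.2) :=
      (continuous_scalarNetwork hl0 hl1 u v).measurable.comp
        ((hTm.comp measurable_fst).prodMk measurable_snd)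
    exact continuous_abs.measurable.comp (h1.sub (hE'm.comp measurable_snd))
  have hFD : ∀ ω x, F ω x ∈ Set.Icc 0 (v - u) := by
    intro ω x
    refine ⟨abs_nonneg _, abs_le.2 ?_⟩
    constructor <;>
      linarith [(hmem (T ω) x).1, (hmem (T ω) x).2, (hE'uv x).1, (hE'uv x).2]
  set μ : Measure (Fin d → ℝ) := P.map (X 0 0 1) with hμ
  have hμp : IsProbabilityMeasure μ := Measure.isProbabilityMeasure_map hX1.aemeasurable
  have hcongr : ∀ ω, Set.EqOn (F ω)
      (fun x => |scalarNetwork hl0 hl1 u v (Θ (kk ω).1 (kk ω).2 ω) x - E x|) (cube d a b) :=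
    fun ω x hx => by simp only [hF, hT, hE'E x hx]
  have hrestr : μ.restrict (cube d a b) = μ := by
    refine Measure.restrict_eq_self_of_ae_mem ?_
    exact (ae_map_iff hX1.aemeasurable measurableSet_cube).2
      (Filter.Eventually.of_forall fun ω => hX 0 0 1 ω)
  have hinner : ∀ ω, ∫ x in cube d a b,
      |scalarNetwork hl0 hl1 u v (Θ (kk ω).1 (kk ω).2 ω) x - E x| ∂μ = ∫ x, F ω x ∂μ := by
    intro ω
    rw [← setIntegral_congr_fun measurableSet_cube (hcongr ω), hrestr]
  simp only [hinner]
  obtain ⟨hint1, hint2, hCS⟩ := integral_integral_le_of_sq_le (P := P) (μ := μ) hFm hFD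
  refine ⟨?_, ?_, hint1, ?_, ?_⟩
  · have h : Measurable (fun z : Ω × cube d a b => Function.uncurry F (z.1, (z.2 : Fin d → ℝ))) :=
      hFm.comp (measurable_fst.prodMk (measurable_subtype_coe.comp measurable_snd))
    convert h using 1
    funext z
    exact (hcongr z.1 z.2.2).symm
  · intro ω
    have h : Integrable (F ω) μ := Integrable.of_mem_Icc 0 (v - u)
      (hFm.comp measurable_prodMk_left).aemeasurable (Filter.Eventually.of_forall (hFD ω))
    exact h.integrableOn.congr_fun (hcongr ω) measurableSet_cube
  · -- the error decomposition
    have hq1 : 1 ≤ numParams l depth := by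
      refine le_trans ?_ (numParams_mono l hdepth)
      rw [show (1 : ℕ) = 0 + 1 from rfl, numParams_succ]
      have := hl 1 hdepth
      nlinarith [Nat.zero_le (l 0)]
    have hqW : (numParams l depth : ℝ) ≤ depth * ((maxWidth l depth : ℝ) + 1) ^ 2 := by
      have h := numParams_le (l := l) (depth := depth) fun k hk => width_le_maxWidth hk
      have h2 : (numParams l depth : ℝ)
          ≤ depth * (maxWidth l depth * (maxWidth l depth + 1)) := by exact_mod_cast h
      refine h2.trans ?_
      rw [pow_two]
      gcongr
      linarith
    obtain ⟨η, hη, hηapp⟩ := exists_scalarNetwork_approx (p := p) hl0 hl1 hd hdepth hl hparams hc1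
      hLip0 hLipc hab hac hbc huc hvc hE hLip
    obtain ⟨H₁, hH₁int, hH₁, hH₁le⟩ := exists_uniform_deviation_bound (p := p) hl0 hl1 hdepth hl hM
      huv.le hc1 hB1 (X := X 0 0) (Y := Y 0 0)
      (fun j ω i => (abs_le_of_mem_Icc hac hbc (mem_cube_iff.1 (hX 0 0 j ω) i)).trans hcB)
      (hY 0 0) hXY
    obtain ⟨H₂, hH₂int, hH₂nn, hH₂, hH₂le⟩ := exists_min_headDist_bound hq1 hK (by linarith)
      hΘiid hΘunif hη
    set α := 3 * d * Lip * (b - a) / (minDepthWidth l depth : ℝ) ^ (1 / (d : ℝ)) with hα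
    have hα0 : 0 ≤ α := by
      have : 0 ≤ b - a := by linarith
      positivity
    set Λ : ℝ := depth * ((maxWidth l depth : ℝ) + 1) ^ depth * c ^ depth with hΛ
    have hηc : ∀ i, |η i| ≤ c := fun i => abs_le.2 (mem_cube_iff.1 hη i)
    have hηB : ‖η‖ ≤ B := (pi_norm_le_iff_of_nonneg (by linarith)).2 fun i => (hηc i).trans hcB
    have hcond' : (fun ω => E' (X 0 0 1 ω)) =ᵐ[P]
        P[Y 0 0 1 | MeasurableSpace.comap (X 0 0 1) MeasurableSpace.pi] := by
      refine Filter.EventuallyEq.trans (Filter.Eventually.of_forall fun ω => ?_) hcond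
      exact (hE'E _ (hX 0 0 1 ω)).symm
    have hrisk : ∀ θ : Fin p → ℝ, ∫ x, |scalarNetwork hl0 hl1 u v θ x - E' x| ^ 2 ∂μ
        = ∫ ω, |scalarNetwork hl0 hl1 u v θ (X 0 0 1 ω) - Y 0 0 1 ω| ^ 2 ∂P
          - ∫ ω, |E' (X 0 0 1 ω) - Y 0 0 1 ω| ^ 2 ∂P := by
      intro θ
      rw [← integral_sq_sub_eq_risk_sub_risk hX1 hY1 (hY 0 0 1) hE'm (hNm θ) hE'uv (hmem θ) hcond',
        hμ, integral_map hX1.aemeasurable]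
      exact ((continuous_abs.measurable.comp
        ((hNm θ).sub hE'm)).pow_const 2).aestronglyMeasurable
    have hηrisk : ∫ x, |scalarNetwork hl0 hl1 u v η x - E' x| ^ 2 ∂μ ≤ α ^ 2 := by
      have h := integral_mono_of_nonneg (μ := μ)
        (f := fun x => |scalarNetwork hl0 hl1 u v η x - E' x| ^ 2) (g := fun _ => α ^ 2)
        (Filter.Eventually.of_forall fun x => by positivity) (integrable_const _) (by
          rw [← hrestr]
          filter_upwards [ae_restrict_mem measurableSet_cube] with x hx
          rw [← hE'E x hx]
          exact pow_le_pow_left₀ (abs_nonneg _) (hηapp x hx) 2)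
      simpa using h
    -- The comparison chain at a fixed outcome: `g1` passes from risk to empirical risk, `g2` to the
    -- initialisation closest to `η`, `g3` to `η`, `g4` back to risk; `g5` and `g6` translate risks
    -- into squared errors.
    have hpath : ∀ᵐ ω ∂P, ∫ x, F ω x ^ 2 ∂μ
        ≤ 2 * H₁ ω + 2 * (v - u) * Λ * H₂ ω + α ^ 2 := by
      filter_upwards [hH₂] with ω hω
      obtain ⟨k, hk, hkc, hkη⟩ := hω
      obtain ⟨hkkmem, hkkmin⟩ := hargmin ω
      have g1 := (abs_le.1 (hH₁ ω (T ω) hkkmem.2.2)).1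
      have hk0B : ‖Θ k 0 ω‖ ≤ B := (pi_norm_le_iff_of_nonneg (by linarith)).2 fun i =>
        abs_le.2 (mem_cube_iff.1 (hΘB k hk.1 ω) i)
      have g2 := hkkmin (k, 0) ⟨hk, hS0, hk0B⟩
      have g3 := (abs_le.1 (abs_empiricalRisk_sub_le (x := fun j => X 0 0 j ω)
        (y := fun j => Y 0 0 j ω) hM huv.le (fun _ => hmem (Θ k 0 ω) _) (fun _ => hmem η _)
        (fun j => hY 0 0 j ω) (fun j => abs_scalarNetwork_sub_le hl0 hl1 hc1 (hH₂nn ω)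
          (fun i _ => abs_le.2 (mem_cube_iff.1 hkc i)) (fun i _ => hηc i) hkη
          (fun i => abs_le_of_mem_Icc hac hbc (mem_cube_iff.1 (hX 0 0 j ω) i))))).2
      have g4 := (abs_le.1 (hH₁ ω η hηB)).2
      have g5 := hrisk (T ω)
      have g6 := hrisk η
      simp only [hF]
      simp only [hT] at g1 g5 ⊢
      simp only at g2
      linarith
    have hQ : ∫ ω, (∫ x, F ω x ^ 2 ∂μ) ∂P
        ≤ 2 * ∫ ω, H₁ ω ∂P + 2 * (v - u) * Λ * ∫ ω, H₂ ω ∂P + α ^ 2 := by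
      have i1 : Integrable (fun ω => 2 * H₁ ω) P := hH₁int.const_mul 2
      have i2 : Integrable (fun ω => 2 * (v - u) * Λ * H₂ ω) P := hH₂int.const_mul _
      have i3 : Integrable (fun ω => 2 * H₁ ω + 2 * (v - u) * Λ * H₂ ω) P := i1.add i2
      have h := integral_mono_ae hint2 (i3.add (integrable_const (α ^ 2))) hpath
      refine h.trans (le_of_eq ?_)
      simp only [Pi.add_apply]
      rw [integral_add i3 (integrable_const _), integral_add i1 i2, integral_const_mul,
        integral_const_mul]
      simp
    have hℓ : 0 ≤ Real.log (3 * M * B * c) := by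
      refine Real.log_nonneg ?_
      exact one_le_mul_of_one_le_of_one_le (one_le_mul_of_one_le_of_one_le (by linarith) hB1) hc1
    have hvu0 : 0 ≤ v - u := by linarith
    obtain ⟨hs1, hs3⟩ := error_terms_sq (D := max 1 (v - u)) (n := depth) hL1 hW1 hc1 hvu0 hK1 hM1
      hℓ hq1 hqW
    set t₁ := 2 * ((v - u) * depth * ((maxWidth l depth : ℝ) + 1) ^ depth
            * c ^ (depth + 1)) ^ (1 / 2 : ℝ)
          / (K : ℝ) ^ ((2 * (depth : ℝ))⁻¹ * (((maxWidth l depth : ℝ) + 1) ^ 2)⁻¹) with ht₁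
    set t₃ := 3 * max 1 (v - u) * ((maxWidth l depth : ℝ) + 1)
            * (2 * (depth : ℝ) * Real.log (3 * M * B * c)) ^ (1 / 2 : ℝ)
          / (M : ℝ) ^ (1 / 4 : ℝ) with ht₃
    have ht₁pos : 0 < t₁ := by
      have : 0 < v - u := by linarith
      positivity
    have ht₃nn : 0 ≤ t₃ := by
      have : 0 ≤ max 1 (v - u) := le_max_of_le_left zero_le_one
      positivity
    -- Here `s` is the sum of the three error terms; it is positive because `t₁` is.
    refine hCS _ (by positivity) (hQ.trans ?_)
    have hb2 : 2 * (v - u) * Λ * ∫ ω, H₂ ω ∂P ≤ t₁ ^ 2 := by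
      refine le_trans ?_ hs1
      gcongr
    have hb1 : 2 * ∫ ω, H₁ ω ∂P ≤ t₃ ^ 2 := by
      rw [← hs3]
      gcongr
    refine le_trans ?_ (sq_add_sq_add_sq_le ht₃nn hα0 ht₁pos.le)
    linarith only [hb1, hb2]
  · exact error_terms_le hd0.le hL1 hW1 hc1 hcB hba (by linarith) hLipc hvu hApos (by linarith)
      hM1
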